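/- **Setting.** Fix integers $D\ge 0$, $k_{IJ}\ge 0$, $N_{loo}\ge 0$, $N_1\ge 1$. Let $g_0,g_1,g_2,\ldots$ be random functions $\mathbb{R}^D\to\mathbb{R}^D$ on a probability space, let $\Omega_\theta\subseteq\mathbb{R}^D$ be a deterministic set, and put $$G(\theta,w)=\frac1N\Big(g_0(\theta)+\sum_{n=1}^N w_n g_n(\theta)\Big),\qquad w\in\mathbb{R}^N,$$ and $H(\theta,w)=\partial G(\theta,w)/\partial\theta$. Write $g_n^{(k)}(\theta)$ and $G^{(k)}(\theta,w)$ for the arrays of all $k$-th order partial derivatives in $\theta$; $\|\cdot\|_2$ and $\|\cdot\|_\infty$ are the norms of the vectorized arrays. Let $1_N$ be the all-ones vector, and $w_{(-n)}\in\mathbb{R}^N$ the vector with $n$-th entry $0$ and all other entries $1$. For radii $\rho_N>0$ (arbitrary, possibly depending on $N$) let $\Omega_w$ be the set of $\tilde w\in\mathbb{R}^N$ within Euclidean distance less than $\rho_N$ of some point of the segment from $1_N$ to $w$. For each $N$, let $\mathscr{N}_N\subseteq\{1,\ldots,N\}$ be a random set of at most $N_{loo}$ indices (for instance exactly $N_{loo}$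 of them), with any distribution, independent of the family of values $g_n(\theta)$, $0\le n\le N$, $\theta\in\Omega_\theta$; let $\mathcal{W}_{loo}=\{w_{(-n)}:n\in\mathscr{N}_N\}$. **Assumptions.** 1. For each $0\le k\le k_{IJ}+1$ the random functions $g_n^{(k)}$ on $\Omega_\theta$, $n\ge1$, are independent and identically distributed, with $\mathbb{E}\|g_n^{(k)}(\theta)\|_2^2<\infty$ for all $\theta\in\Omega_\theta$. 2. Almost surely, $\sup_{\theta\in\Omega_\theta}\|g_n^{(k)}(\theta)\|_\infty<\infty$ for all $n\ge1$ and $0\le k\le k_{IJ}+1$ (not necessarily uniformly in $n$). 3. There are $r>0$ and finite bounds $C_{op}$ and $M_k$, none depending on $N$ ($r$ is deterministic; $C_{op}$ and $M_k$ are constants or, more generally, real random variables), such that almost surely, for all $N\ge N_1$: - for each $w\in\mathcal{W}_{loo}$ and each $\tilde w\in\Omega_w$, $\hat\theta(\tilde w)$ is a solution of $G(\hat\theta(\tilde w),\tilde w)=0$, and $\Omega_\theta$ is open and contains the open $r$-neighbourhood of the convex hull of $\{\hat\theta(\tilde w):\tilde w\in\Omega_w\}$; - every $g_n$, $n\ge0$,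 is $k_{IJ}+1$ times continuously differentiable on $\Omega_\theta$; - for all $\theta\in\Omega_\theta$, $H(\theta,1_N)$ is positive definite ($v^\top H(\theta,1_N)v>0$ for $v\ne0$) and $\|H(\theta,1_N)^{-1}\|_{op}\le C_{op}$; - $\|G^{(k)}(\theta,1_N)\|_2\le M_k$ for all $\theta\in\Omega_\theta$ and $1\le k\le k_{IJ}+1$. **Jackknife.** Let $d^k\hat\theta(1_N)$ be the $k$-th directional derivative of $\tilde w\mapsto\hat\theta(\tilde w)$ at $1_N$ in the direction $w-1_N$, and $$\hat\theta^{IJ}_{k_{IJ}}(w)=\hat\theta(1_N)+\sum_{k=1}^{k_{IJ}}\frac1{k!}\,d^k\hat\theta(1_N).$$ **Conclusion.** For every $\epsilon>0$ there are $C$ and $N_0$ such that for every $N\ge N_0$, with probability at least $1-\epsilon$ (that is, on a measurable event of at least this probability), $\hat\theta(\cdot)$ is $k_{IJ}$ times continuously differentiable at $1_N$ (so that the jackknife is defined) whenever $\mathcal{W}_{loo}\neq\emptyset$, and $$\max_{w\in\mathcal{W}_{loo}}\big\|\hat\theta^{IJ}_{k_{IJ}}(w)-\hat\theta(w)\big\|_2\le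 C\,N^{-(k_{IJ}+1)}.$$ -/

import Mathlib

open MeasureTheory ProbabilityTheory

namespace HOIJ

/-- The parameter space `ℝ^D` with its Euclidean norm. -/
abbrev Param (D : ℕ) : Type := EuclideanSpace ℝ (Fin D)

/-- Weight vectors `w = (w_1, …, w_N)` with the Euclidean norm; coordinate `i : Fin N` is the
weight of observation number `i + 1`. -/
abbrev Weight (N : ℕ) : Type := EuclideanSpace ℝ (Fin N)

/-- The all-ones weight vector `1_N`. -/
noncomputable def ones (N : ℕ) : Weight N := WithLp.toLp 2 (fun _ => 1)

/-- The leave-one-out weight vector: `0` in coordinate `i` and `1` elsewhere. -/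
noncomputable def loo (N : ℕ) (i : Fin N) : Weight N :=
  WithLp.toLp 2 (fun j => if j = i then 0 else 1)

/-- `G(θ, w) = (1/N) (g_0(θ) + ∑_{n=1}^N w_n g_n(θ))`. -/
noncomputable def G {D : ℕ} (g : ℕ → Param D → Param D) (N : ℕ) (θ : Param D) (w : Weight N) :
    Param D :=
  (1 / (N : ℝ)) • (g 0 θ + ∑ i : Fin N, w i • g (i + 1) θ)

/-- The array, with `D^(k+1)` entries, of all `k`-th order partial derivatives of `f` at `θ`: the
entry `((d_1, …, d_k), j)` is `∂^k f_j / ∂θ_{d_1} … ∂θ_{d_k}`. As an element of a finite product of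
copies of `ℝ` its norm `‖·‖` is the maximal absolute value of its entries. -/
noncomputable def derivArray {D : ℕ} (k : ℕ) (f : Param D → Param D) (θ : Param D) :
    (Fin k → Fin D) × Fin D → ℝ :=
  fun p => iteratedFDeriv ℝ k f θ (fun l => EuclideanSpace.single (p.1 l) (1 : ℝ)) p.2

/-- The `L_2` norm of a vectorized array. -/
noncomputable def norm2 {ι : Type*} [Fintype ι] (a : ι → ℝ) : ℝ := Real.sqrt (∑ i, a i ^ 2)

/-- The open `ρ`-neighbourhood `Ω_w` of the segment from `1_N` to `w`. -/
def wDom {N : ℕ} (ρ : ℝ) (w : Weight N) : Set (Weight N) :=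
  {v | ∃ t ∈ Set.Icc (0 : ℝ) 1, ‖v - ((1 - t) • ones N + t • w)‖ < ρ}

/-- Domain assumption for one weight vector `w`: `that v` solves the estimating equation for each
`v ∈ Ω_w`, and the open set `Ωθ` contains the `r`-enlargement of the convex hull of these
solutions. -/
def ThetaDom {D : ℕ} (g : ℕ → Param D → Param D) (Ωθ : Set (Param D)) (r ρ : ℝ) {N : ℕ}
    (that : Weight N → Param D) (w : Weight N) : Prop :=
  (∀ v ∈ wDom ρ w, G g N (that v) v = 0) ∧
  IsOpen Ωθ ∧
  Metric.thickening r (convexHull ℝ (that '' wDom ρ w)) ⊆ Ωθ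

/-- Smoothness: every `g_n`, `0 ≤ n`, is `kIJ + 1` times continuously differentiable on `Ωθ`. -/
def Diffable {D : ℕ} (g : ℕ → Param D → Param D) (Ωθ : Set (Param D)) (kIJ : ℕ) : Prop :=
  ∀ n : ℕ, ContDiffOn ℝ ((kIJ + 1 : ℕ) : WithTop ℕ∞) (g n) Ωθ

/-- `H(θ, w) = ∂G(θ, w)/∂θ`. -/
noncomputable def H {D : ℕ} (g : ℕ → Param D → Param D) (N : ℕ) (θ : Param D) (w : Weight N) :
    Param D →L[ℝ] Param D :=
  fderiv ℝ (fun η => G g N η w) θ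

/-- Strong positive definiteness: on `Ωθ`, `H(θ, 1_N)` is positive definite (so invertible;
symmetry is not required), and the operator norm of its inverse is at most `Cop`. -/
def Convexity {D : ℕ} (g : ℕ → Param D → Param D) (Ωθ : Set (Param D)) (N : ℕ) (Cop : ℝ) : Prop :=
  ∀ θ ∈ Ωθ, (∀ v : Param D, v ≠ 0 → 0 < inner ℝ v (H g N θ (ones N) v)) ∧
    ‖(H g N θ (ones N)).inverse‖ ≤ Cop

/-- Boundedness: `‖∂^k G(θ, 1_N)/∂θ^k‖_2 ≤ M_k` on `Ωθ` for `1 ≤ k ≤ kIJ + 1`. -/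
def Bounded {D : ℕ} (g : ℕ → Param D → Param D) (Ωθ : Set (Param D)) (kIJ N : ℕ) (M : ℕ → ℝ) :
    Prop :=
  ∀ k, 1 ≤ k → k ≤ kIJ + 1 → ∀ θ ∈ Ωθ, norm2 (derivArray k (fun η => G g N η (ones N)) θ) ≤ M k

/-- For `0 ≤ k ≤ kIJ + 1`, the random functions `θ ↦ ∂^k g_n(θ)`, `n ≥ 1`, on `Ωθ` are independent
and identically distributed, and their values are square integrable. The `σ`-algebra on the space
of functions on `Ωθ` is the one generated by the evaluations. -/
def CondIID {D : ℕ} {Ω : Type*} [MeasurableSpace Ω] (P : Measure Ω)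
    (g : ℕ → Ω → Param D → Param D) (Ωθ : Set (Param D)) (kIJ : ℕ) : Prop :=
  ∀ k ≤ kIJ + 1,
    (∀ n ≥ 1, ∀ θ ∈ Ωθ, Measurable (fun ω => derivArray k (g n ω) θ)) ∧
    iIndepFun (fun (n : ℕ) (ω : Ω) (θ : Ωθ) => derivArray k (g (n + 1) ω) θ) P ∧
    (∀ n ≥ 1, IdentDistrib (fun (ω : Ω) (θ : Ωθ) => derivArray k (g n ω) θ)
      (fun (ω : Ω) (θ : Ωθ) => derivArray k (g 1 ω) θ) P P) ∧
    (∀ n ≥ 1, ∀ θ ∈ Ωθ, Integrable (fun ω => norm2 (derivArray k (g n ω) θ) ^ 2) P)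

/-- `sup_{θ ∈ Ωθ} ‖∂^k g_n(θ)‖_∞ < ∞` for each `n ≥ 1` and `0 ≤ k ≤ kIJ + 1`; the bound may depend
on `n`. -/
def SupTerms {D : ℕ} (g : ℕ → Param D → Param D) (Ωθ : Set (Param D)) (kIJ : ℕ) : Prop :=
  ∀ k ≤ kIJ + 1, ∀ n ≥ 1, BddAbove ((fun θ => ‖derivArray k (g n) θ‖) '' Ωθ)

/-- For each `N`, `S N` is a random set of at most `Nloo` of the `N` observations (so exactly `Nloo`
of them, or `Nloo` draws with replacement, are allowed), with an arbitrary law, that is independent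
of the family of values `g_n(θ)`, `0 ≤ n ≤ N`, `θ ∈ Ωθ`. -/
def RandomIndices {D : ℕ} {Ω : Type*} [MeasurableSpace Ω] (P : Measure Ω)
    (g : ℕ → Ω → Param D → Param D) (Ωθ : Set (Param D)) (Nloo : ℕ)
    (S : (N : ℕ) → Ω → Finset (Fin N)) : Prop :=
  ∀ N : ℕ,
    (∀ ω, (S N ω).card ≤ Nloo) ∧
    (∀ s : Finset (Fin N), MeasurableSet (S N ⁻¹' {s})) ∧
    Indep (MeasurableSpace.comap (S N) ⊤)
      (MeasurableSpace.comap (fun (ω : Ω) (p : Fin (N + 1) × Ωθ) => g p.1 ω p.2)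
        MeasurableSpace.pi) P

/-- The `k`-th directional derivative of the estimator in the direction `Δ`, at weights `v`. -/
noncomputable def dTheta {D N : ℕ} (that : Weight N → Param D) (k : ℕ) (v Δ : Weight N) : Param D :=
  iteratedFDeriv ℝ k that v (fun _ => Δ)

/-- The higher-order infinitesimal jackknife of order `kIJ`. -/
noncomputable def thetaIJ {D N : ℕ} (that : Weight N → Param D) (kIJ : ℕ) (w : Weight N) :
    Param D :=
  that (ones N) +
    ∑ k ∈ Finset.Icc 1 kIJ, (1 / (Nat.factorial k : ℝ)) • dTheta that k (ones N) (w - ones N)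

/-- The error of the jackknife of order `kIJ`. -/
noncomputable def errIJ {D N : ℕ} (that : Weight N → Param D) (kIJ : ℕ) (w : Weight N) : ℝ :=
  ‖thetaIJ that kIJ w - that w‖

end HOIJ

open Filter Topology

/-! ### Uniform bounds for inversion of linear maps -/

section Antilipschitz

variable {E : Type*} [NormedAddCommGroup E] [NormedSpace ℝ E] [FiniteDimensional ℝ E]

/-! Put `F = G(·, 1_N)` and let `h` be the term left out. On the line from `1_N` to the
leave-one-out weight, at time `t`, the estimating equation is `F θ = s h(θ)` with `s = t/N`. In the
variable `s` the solution is a curve `Θ` on `[0, 1/N]`, and the jackknife is its Taylor polynomial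
at `0` evaluated at `1/N`. The error is thus at most `B N^{-(kIJ+1)}` if `B` bounds the derivative
of `Θ` of order `kIJ + 1`.

Such a `B` comes from `Θ' = (F'(Θ) - s h'(Θ))⁻¹ h(Θ)` by induction on the order
(`exists_bound_iteratedFDeriv_implicit_curve`); it depends only on bounds for the derivatives of `F`
and `h` and for the inverse. Smoothness of the estimator is not assumed: positive definiteness on a
convex neighbourhood of the solutions gives continuity (`continuousAt_of_perturbed_equation`), and
the implicit function theorem does the rest. All this is combined in `exists_errIJ_le`.

Probability enters only to bound the derivatives of the few terms left out, along with the random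
bounds `Cop` and `M`. The supremum of the derivatives of one term is almost surely finite, hence at
most some `K` outside an event of probability `δ`; identical distribution gives the same `K` for
every term. As the index set is independent of the terms, the probability that a chosen term exceeds
`K` is at most `∑ P(i ∈ S) δ ≤ Nloo δ` (`measure_exists_exceeds_le`). -/

theorem ContinuousLinearMap.isInvertible_of_injective {A : E →L[ℝ] E}
    (h : Function.Injective A) : A.IsInvertible :=
  ⟨(LinearEquiv.ofInjectiveEndo (A : E →ₗ[ℝ] E) h).toContinuousLinearEquiv, by ext; rfl⟩

theorem ContinuousLinearMap.isInvertible_of_norm_le {A : E →L[ℝ] E} {c : ℝ}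
    (h : ∀ u, ‖u‖ ≤ c * ‖A u‖) : A.IsInvertible := by
  refine ContinuousLinearMap.isInvertible_of_injective
    ((injective_iff_map_eq_zero A).2 fun u hu => ?_)
  have := h u
  rw [hu, norm_zero, mul_zero] at this
  exact norm_le_zero_iff.1 this

/-- The derivatives of the inversion of linear maps are bounded, uniformly over all maps of bounded
norm whose inverse has bounded norm. -/
theorem exists_bound_iteratedFDeriv_inverse (E : Type*) [NormedAddCommGroup E] [NormedSpace ℝ E]
    [FiniteDimensional ℝ E] (c m : ℝ) (n : ℕ) :
    ∃ B : ℝ, ∀ A : E →L[ℝ] E, ‖A‖ ≤ m → (∀ u, ‖u‖ ≤ c * ‖A u‖) → ∀ i ≤ n,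
      ‖iteratedFDeriv ℝ i (ContinuousLinearMap.inverse : (E →L[ℝ] E) → (E →L[ℝ] E)) A‖ ≤ B := by
  have : ProperSpace (E →L[ℝ] E) := FiniteDimensional.proper ℝ _
  have : CompleteSpace E := FiniteDimensional.complete ℝ E
  -- Uniformity comes from compactness: `S` is closed, bounded and made of invertible maps, near
  -- which inversion is smooth.
  let S : Set (E →L[ℝ] E) := Metric.closedBall 0 m ∩ {A | ∀ u, ‖u‖ ≤ c * ‖A u‖}
  have hS : IsCompact S := by
    refine (isCompact_closedBall 0 m).inter_right ?_
    simp only [Set.ofPred_forall]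
    refine isClosed_iInter fun u => isClosed_le continuous_const ?_
    fun_prop
  have key : ∀ i : ℕ, ∃ B : ℝ, ∀ A ∈ S,
      ‖iteratedFDeriv ℝ i (ContinuousLinearMap.inverse : (E →L[ℝ] E) → (E →L[ℝ] E)) A‖ ≤ B := by
    intro i
    refine hS.exists_bound_of_continuousOn fun A hA => ContinuousAt.continuousWithinAt ?_
    have := (ContinuousLinearMap.isInvertible_of_norm_le hA.2).contDiffAt_map_inverse
      (𝕜 := ℝ) (n := ((i : ℕ) : WithTop ℕ∞))
    exact (this.iteratedFDeriv_right (m := 0) (by simp)).continuousAt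
  choose B hB using key
  refine ⟨∑ i ∈ Finset.range (n + 1), |B i|, fun A hA hc i hi => ?_⟩
  refine ((hB i A ⟨by simpa using hA, hc⟩).trans (le_abs_self _)).trans ?_
  exact Finset.single_le_sum (f := fun i => |B i|) (fun _ _ => abs_nonneg _)
    (Finset.mem_range.2 (by omega))

end Antilipschitz

/-! ### Calculus of derivative bounds -/

section DerivBounds

variable {E F G : Type*} [NormedAddCommGroup E] [NormedSpace ℝ E] [NormedAddCommGroup F]
  [NormedSpace ℝ F] [NormedAddCommGroup G] [NormedSpace ℝ G]

/-- `f` is `C^n` at `x` and its derivatives of order at most `n` have norm at most `B` at `x`. -/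
def DerivBound (n : ℕ) (B : ℝ) (f : E → F) (x : E) : Prop :=
  ContDiffAt ℝ n f x ∧ ∀ i ≤ n, ‖iteratedFDeriv ℝ i f x‖ ≤ B

theorem ContDiffAt.exists_isOpen_contDiffOn {n : ℕ} {f : E → F} {x : E} (hf : ContDiffAt ℝ n f x) :
    ∃ u : Set E, IsOpen u ∧ x ∈ u ∧ ContDiffOn ℝ n f u := by
  obtain ⟨u, hu, h⟩ := hf.contDiffOn (m := n) le_rfl (by simp)
  obtain ⟨v, hv, hvo, hxv⟩ := mem_nhds_iff.1 (by simpa using hu)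
  exact ⟨v, hvo, hxv, h.mono hv⟩

theorem DerivBound.nonneg {n : ℕ} {B : ℝ} {f : E → F} {x : E} (h : DerivBound n B f x) : 0 ≤ B :=
  (norm_nonneg _).trans (h.2 0 (Nat.zero_le _))

theorem DerivBound.norm_le {n : ℕ} {B : ℝ} {f : E → F} {x : E} (h : DerivBound n B f x) :
    ‖f x‖ ≤ B := by
  simpa using h.2 0 (Nat.zero_le _)

theorem DerivBound.sub {n : ℕ} {B B' : ℝ} {f g : E → F} {x : E} (hf : DerivBound n B f x)
    (hg : DerivBound n B' g x) : DerivBound n (B + B') (fun y => f y - g y) x := by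
  refine ⟨hf.1.sub hg.1, fun i hi => ?_⟩
  have hi' : (i : WithTop ℕ∞) ≤ n := by exact_mod_cast hi
  have h := iteratedFDeriv_sub_apply (hf.1.of_le hi') (hg.1.of_le hi')
  change ‖iteratedFDeriv ℝ i (f - g) x‖ ≤ _
  rw [h]
  exact (norm_sub_le _ _).trans (add_le_add (hf.2 i hi) (hg.2 i hi))

theorem DerivBound.clm_apply {n : ℕ} {B B' : ℝ} {f : E → F →L[ℝ] G} {g : E → F} {x : E}
    (hf : DerivBound n B f x) (hg : DerivBound n B' g x) :
    DerivBound n (2 ^ n * (B * B')) (fun y => f y (g y)) x := by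
  refine ⟨hf.1.clm_apply hg.1, fun i hi => ?_⟩
  obtain ⟨u, huo, hxu, hu⟩ := hf.1.exists_isOpen_contDiffOn
  obtain ⟨v, hvo, hxv, hv⟩ := hg.1.exists_isOpen_contDiffOn
  have ho := huo.inter hvo
  have h := norm_iteratedFDerivWithin_clm_apply (hu.mono Set.inter_subset_left)
    (hv.mono Set.inter_subset_right) ho.uniqueDiffOn ⟨hxu, hxv⟩
    (n := i) (by exact_mod_cast hi)
  simp only [iteratedFDerivWithin_of_isOpen _ ho ⟨hxu, hxv⟩] at h
  refine h.trans ?_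
  calc _ ≤ ∑ j ∈ Finset.range (i + 1), (i.choose j : ℝ) * (B * B') := by
        refine Finset.sum_le_sum fun j hj => ?_
        have hj' : j ≤ i := by simpa [Nat.lt_succ_iff] using hj
        rw [mul_assoc]
        exact mul_le_mul_of_nonneg_left (mul_le_mul (hf.2 j (by omega)) (hg.2 (i - j) (by omega))
          (norm_nonneg _) hf.nonneg) (Nat.cast_nonneg _)
    _ = 2 ^ i * (B * B') := by
        rw [← Finset.sum_mul]
        congr 1
        exact_mod_cast Nat.sum_range_choose i
    _ ≤ _ := mul_le_mul_of_nonneg_right (pow_le_pow_right₀ one_le_two hi)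
        (mul_nonneg hf.nonneg hg.nonneg)

/-- Faà di Bruno's formula. Only derivatives of `f` of positive order enter, so `f` itself need not
be bounded; `1 ≤ B'` gives `B' ≤ B' ^ j`, the form of bound that is needed at order `j`. -/
theorem DerivBound.comp {n : ℕ} {B B' : ℝ} {g : F → G} {f : E → F} {x : E}
    (hg : DerivBound n B g (f x)) (hf : ContDiffAt ℝ n f x) (hB' : 1 ≤ B')
    (hfB : ∀ i, 1 ≤ i → i ≤ n → ‖iteratedFDeriv ℝ i f x‖ ≤ B') :
    DerivBound n (n.factorial * B * B' ^ n) (fun y => g (f y)) x := by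
  refine ⟨hg.1.comp x hf, fun i hi => ?_⟩
  obtain ⟨v, hvo, hxv, hv⟩ := hg.1.exists_isOpen_contDiffOn
  obtain ⟨u, huo, hxu, hu⟩ := hf.exists_isOpen_contDiffOn
  have ho : IsOpen (u ∩ f ⁻¹' v) := hu.continuousOn.isOpen_inter_preimage huo hvo
  have hx : x ∈ u ∩ f ⁻¹' v := ⟨hxu, hxv⟩
  have h := norm_iteratedFDerivWithin_comp_le hv (hu.mono Set.inter_subset_left)
    (n := i) (by exact_mod_cast hi) hvo.uniqueDiffOn ho.uniqueDiffOn (fun y hy => hy.2) hx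
    (C := B) (D := B')
    (fun j hj => by
      rw [iteratedFDerivWithin_of_isOpen _ hvo hxv]; exact hg.2 j (hj.trans hi))
    (fun j hj hj' => by
      rw [iteratedFDerivWithin_of_isOpen _ ho hx]
      exact (hfB j hj (hj'.trans hi)).trans (le_self_pow₀ hB' (by omega)))
  rw [iteratedFDerivWithin_of_isOpen _ ho hx] at h
  refine h.trans ?_
  have := hg.nonneg
  gcongr

theorem DerivBound.fderiv_right {n : ℕ} {B : ℝ} {f : E → F} {x : E}
    (hf : ContDiffAt ℝ (n + 1 : ℕ) f x)
    (hB : ∀ i, 1 ≤ i → i ≤ n + 1 → ‖iteratedFDeriv ℝ i f x‖ ≤ B) :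
    DerivBound n B (fderiv ℝ f) x :=
  ⟨hf.fderiv_right (by norm_cast), fun i hi => by
    rw [norm_iteratedFDeriv_fderiv]; exact hB (i + 1) (by omega) (by omega)⟩

/-- Leibniz' rule for the linear map `t ↦ (t • ·)`: its derivatives of order at least two vanish,
and the others have norm at most one for `|s| ≤ 1`. -/
theorem DerivBound.id_smul {n : ℕ} {B s : ℝ} {f : ℝ → F} (hs : |s| ≤ 1)
    (hf : DerivBound n B f s) : DerivBound n (2 ^ n * B) (fun t => t • f t) s := by
  let L : ℝ →L[ℝ] F →L[ℝ] F := ContinuousLinearMap.lsmul ℝ ℝ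
  have hL : DerivBound n 1 (fun t : ℝ => L t) s := by
    refine ⟨L.contDiff.contDiffAt, fun i _ => ?_⟩
    have hl : ‖L‖ ≤ 1 := ContinuousLinearMap.opNorm_lsmul_le
    rcases i with _ | _ | i
    · rw [norm_iteratedFDeriv_zero]
      exact ((L.le_opNorm s).trans (mul_le_mul hl hs (norm_nonneg _) zero_le_one)).trans
        (by norm_num)
    · rw [zero_add, norm_iteratedFDeriv_one, L.fderiv]
      exact hl
    · rw [← norm_iteratedFDeriv_fderiv]
      have : fderiv ℝ (fun t : ℝ => L t) = fun _ => L := by ext1; exact L.fderiv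
      rw [this, iteratedFDeriv_const_of_ne (by omega)]
      simp
  have := hL.clm_apply hf
  rwa [one_mul] at this

end DerivBounds

/-! ### Derivatives of the solution curve -/

section ImplicitCurve

variable {E : Type*} [NormedAddCommGroup E] [NormedSpace ℝ E] [FiniteDimensional ℝ E]

/-- The derivative of a curve `Θ` with `F (Θ t) = t • h (Θ t)`. -/
theorem eventually_deriv_eq_inverse {F h : E → E} {Θ : ℝ → E} {s : ℝ}
    (heq : ∀ᶠ t in 𝓝 s, F (Θ t) = t • h (Θ t))
    (hF : ContDiffAt ℝ 1 F (Θ s)) (hh : ContDiffAt ℝ 1 h (Θ s)) (hΘ : ContDiffAt ℝ 1 Θ s)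
    (hinv : (fderiv ℝ F (Θ s) - s • fderiv ℝ h (Θ s)).IsInvertible) :
    deriv Θ =ᶠ[𝓝 s] fun t =>
      (fderiv ℝ F (Θ t) - t • fderiv ℝ h (Θ t)).inverse (h (Θ t)) := by
  have : CompleteSpace E := FiniteDimensional.complete ℝ E
  have hc : ContinuousAt Θ s := hΘ.continuousAt
  have hA : ContinuousAt (fun t => fderiv ℝ F (Θ t) - t • fderiv ℝ h (Θ t)) s := by
    have h1 : ContinuousAt (fun t => fderiv ℝ F (Θ t)) s :=
      ContinuousAt.comp (f := Θ) (hF.fderiv_right (m := 0) (by simp)).continuousAt hc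
    have h2 : ContinuousAt (fun t => fderiv ℝ h (Θ t)) s :=
      ContinuousAt.comp (f := Θ) (hh.fderiv_right (m := 0) (by simp)).continuousAt hc
    exact h1.sub (continuousAt_id.smul h2)
  have hinv' : ∀ᶠ t in 𝓝 s, (fderiv ℝ F (Θ t) - t • fderiv ℝ h (Θ t)).IsInvertible := by
    obtain ⟨e, he⟩ := hinv
    have : Set.range ((↑) : (E ≃L[ℝ] E) → E →L[ℝ] E) ∈
        𝓝 (fderiv ℝ F (Θ s) - s • fderiv ℝ h (Θ s)) := by
      rw [← he]; exact e.nhds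
    filter_upwards [hA.eventually this] with t ht using ht
  filter_upwards [heq.eventually_nhds, hc.eventually (hF.eventually (by simp)),
    hc.eventually (hh.eventually (by simp)), hΘ.eventually (by simp), hinv'] with t h1 h2 h3 h4 h5
  -- Differentiating both sides of the equation gives `F'(Θ) Θ' = h(Θ) + t h'(Θ) Θ'`, to be solved
  -- for `Θ'`.
  have dΘ : HasDerivAt Θ (deriv Θ t) t := (h4.differentiableAt one_ne_zero).hasDerivAt
  have dF := (h2.differentiableAt one_ne_zero).hasFDerivAt.comp_hasDerivAt t dΘ
  have dh := (h3.differentiableAt one_ne_zero).hasFDerivAt.comp_hasDerivAt t dΘ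
  have dr := (hasDerivAt_id t).smul dh
  have := (dF.congr_of_eventuallyEq (f₁ := fun t => t • h (Θ t))
    (h1.mono fun _ h => h.symm)).unique dr
  symm
  rw [h5.inverse_apply_eq]
  simp only [sub_apply, smul_apply]
  rw [this]
  simp

/-- The derivatives of a curve `Θ` with `F (Θ t) = t • h (Θ t)` are bounded in terms of bounds for
the derivatives of `F` and `h` and for the inverse of the linearization. -/
theorem exists_bound_iteratedFDeriv_implicit_curve (E : Type*) [NormedAddCommGroup E]
    [NormedSpace ℝ E] [FiniteDimensional ℝ E] (c m : ℝ) (n : ℕ) :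
    ∃ B : ℝ, 1 ≤ B ∧ ∀ (F h : E → E) (Θ : ℝ → E) (s : ℝ), |s| ≤ 1 →
      (∀ᶠ t in 𝓝 s, F (Θ t) = t • h (Θ t)) →
      ContDiffAt ℝ n F (Θ s) → ContDiffAt ℝ n h (Θ s) → ContDiffAt ℝ n Θ s →
      (∀ i, 1 ≤ i → i ≤ n → ‖iteratedFDeriv ℝ i F (Θ s)‖ ≤ m) →
      (∀ i ≤ n, ‖iteratedFDeriv ℝ i h (Θ s)‖ ≤ m) →
      (∀ u, ‖u‖ ≤ c * ‖(fderiv ℝ F (Θ s) - s • fderiv ℝ h (Θ s)) u‖) →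
      ∀ i, 1 ≤ i → i ≤ n → ‖iteratedFDeriv ℝ i Θ s‖ ≤ B := by
  have : CompleteSpace E := FiniteDimensional.complete ℝ E
  induction n with
  | zero => exact ⟨1, le_rfl, fun _ _ _ _ _ _ _ _ _ _ _ _ i h1 h2 => by omega⟩
  | succ n ih =>
    obtain ⟨B, hB1, hB⟩ := ih
    -- `a` bounds the derivatives up to order `n` of `t ↦ F'(Θ t) - t h'(Θ t)`, and `b` those of
    -- inversion at its value. `B'` then bounds those of the formula for `Θ'`; `a' ≥ 1` is what
    -- `DerivBound.comp` requires.
    let a : ℝ := n.factorial * m * B ^ n + 2 ^ n * (n.factorial * m * B ^ n)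
    obtain ⟨b, hb⟩ := exists_bound_iteratedFDeriv_inverse E c a n
    let a' : ℝ := max a 1
    let B' : ℝ := 2 ^ n * ((n.factorial * b * a' ^ n) * (n.factorial * m * B ^ n))
    refine ⟨max B B', hB1.trans (le_max_left _ _), fun F h Θ s hs heq hF hh hΘ hFm hhm hc => ?_⟩
    have hle : ((n : ℕ) : WithTop ℕ∞) ≤ ((n + 1 : ℕ) : WithTop ℕ∞) := by
      exact_mod_cast Nat.le_succ n
    have hone : (1 : WithTop ℕ∞) ≤ ((n + 1 : ℕ) : WithTop ℕ∞) := by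
      exact_mod_cast Nat.le_add_left 1 n
    have hlow := hB F h Θ s hs heq (hF.of_le hle) (hh.of_le hle) (hΘ.of_le hle)
      (fun i h1 h2 => hFm i h1 (by omega)) (fun i h2 => hhm i (by omega)) hc
    intro i hi hi'
    rcases Nat.lt_or_ge n i with hin | hin
    swap
    · exact (hlow i hi hin).trans (le_max_left _ _)
    obtain rfl : i = n + 1 := by omega
    refine le_trans ?_ (le_max_right _ _)
    have hΘn := hΘ.of_le hle
    have dF := (DerivBound.fderiv_right hF hFm).comp hΘn hB1 hlow
    have dh' := (DerivBound.fderiv_right hh fun i _ h2 => hhm i h2).comp hΘn hB1 hlow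
    have dh := (show DerivBound n m h (Θ s) from
      ⟨hh.of_le hle, fun i h2 => hhm i (by omega)⟩).comp hΘn hB1 hlow
    have dA := dF.sub (dh'.id_smul hs)
    have hinv := ContinuousLinearMap.isInvertible_of_norm_le hc
    have dinv : DerivBound n b (ContinuousLinearMap.inverse : (E →L[ℝ] E) → (E →L[ℝ] E))
        (fderiv ℝ F (Θ s) - s • fderiv ℝ h (Θ s)) :=
      ⟨hinv.contDiffAt_map_inverse, hb _ dA.norm_le hc⟩
    have dI := dinv.comp (f := fun t => fderiv ℝ F (Θ t) - t • fderiv ℝ h (Θ t)) dA.1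
      (le_max_right a 1) (fun i _ h2 => (dA.2 i h2).trans (le_max_left _ _))
    have dfin := dI.clm_apply dh
    have hder := eventually_deriv_eq_inverse heq (hF.of_le hone) (hh.of_le hone)
      (hΘ.of_le hone) hinv
    have := dfin.2 n le_rfl
    rw [norm_iteratedFDeriv_eq_norm_iteratedDeriv] at this ⊢
    rw [iteratedDeriv_succ', hder.iteratedDeriv_eq]
    exact this

end ImplicitCurve

/-! ### Quantitative inversion and continuity of solutions -/

section QuantitativeInverse

variable {E : Type*} [NormedAddCommGroup E] [InnerProductSpace ℝ E] [FiniteDimensional ℝ E]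

omit [FiniteDimensional ℝ E] in
-- If `F x = F y`, Rolle's theorem for `t ↦ ⟪y - x, F (x + t (y - x))⟫` contradicts positivity.
theorem injOn_of_inner_fderiv_pos {U : Set E} (hU : Convex ℝ U) {F : E → E}
    (hF : ∀ x ∈ U, DifferentiableAt ℝ F x)
    (hpos : ∀ x ∈ U, ∀ v : E, v ≠ 0 → 0 < inner ℝ v (fderiv ℝ F x v)) : Set.InjOn F U := by
  intro x hx y hy hxy
  by_contra hne
  have hv : y - x ≠ 0 := sub_ne_zero.2 (Ne.symm hne)
  have hmem : ∀ t ∈ Set.Icc (0 : ℝ) 1, x + t • (y - x) ∈ U := fun t ht =>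
    hU.add_smul_sub_mem hx hy ht
  have hd : ∀ t ∈ Set.Icc (0 : ℝ) 1,
      HasDerivAt (fun t : ℝ => inner ℝ (y - x) (F (x + t • (y - x))))
        (inner ℝ (y - x) (fderiv ℝ F (x + t • (y - x)) (y - x))) t := by
    intro t ht
    have h1 : HasDerivAt (fun t : ℝ => x + t • (y - x)) (y - x) t := by
      simpa using ((hasDerivAt_id t).smul_const (y - x)).const_add x
    have h2 := (hF _ (hmem t ht)).hasFDerivAt.comp_hasDerivAt t h1
    exact (innerSL ℝ (y - x)).hasFDerivAt.comp_hasDerivAt t h2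
  obtain ⟨t, ht, h0⟩ := exists_hasDerivAt_eq_zero (f := fun t : ℝ =>
      inner ℝ (y - x) (F (x + t • (y - x))))
    (f' := fun t => inner ℝ (y - x) (fderiv ℝ F (x + t • (y - x)) (y - x)))
    zero_lt_one (fun t ht => (hd t ht).continuousAt.continuousWithinAt)
    (by simp [hxy]) (fun t ht => hd t ⟨ht.1.le, ht.2.le⟩)
  have := hpos _ (hmem t ⟨ht.1.le, ht.2.le⟩) _ hv
  linarith

/-- A function on a convex set whose derivative is positive definite with inverse bounded by `c`
has an inverse that is locally Lipschitz with constant `c`, quantitatively. -/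
theorem norm_sub_le_of_inner_fderiv_pos {U : Set E} (hU : Convex ℝ U) {F : E → E}
    (hF : ∀ x ∈ U, DifferentiableAt ℝ F x)
    (hpos : ∀ x ∈ U, ∀ v : E, v ≠ 0 → 0 < inner ℝ v (fderiv ℝ F x v))
    {c r : ℝ} (hinv : ∀ x ∈ U, ∀ u, ‖u‖ ≤ c * ‖fderiv ℝ F x u‖) (hc : 0 ≤ c) {x y : E}
    (hx : Metric.ball x r ⊆ U) (hy : y ∈ U) (hxy : c * ‖F y - F x‖ < r) :
    ‖y - x‖ ≤ c * ‖F y - F x‖ := by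
  have : ProperSpace E := FiniteDimensional.proper ℝ E
  have hinj := injOn_of_inner_fderiv_pos hU hF hpos
  have key : ∀ b, c < b → b * ‖F y - F x‖ < r → ‖y - x‖ ≤ b * ‖F y - F x‖ := by
    intro b hb hbr
    have hb0 : 0 < b := hc.trans_lt hb
    set R := (b * ‖F y - F x‖ + r) / 2 with hR
    have hRr : R < r := by rw [hR]; linarith
    have hbR : b * ‖F y - F x‖ < R := by rw [hR]; linarith
    have hR0 : 0 ≤ R := (by positivity : 0 ≤ b * ‖F y - F x‖).trans hbR.le
    have hsub : Metric.closedBall x R ⊆ U := (Metric.closedBall_subset_ball hRr).trans hx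
    -- Ekeland-type argument. A minimizer `z` of `φ` with `F z = F y` equals `y` by injectivity, and
    -- comparison with `φ x` is the claim. Otherwise a short step along the Newton direction `d`
    -- lowers the first summand at rate `b ‖F z - F y‖` and raises the second at rate at most `c ‖F
    -- z - F y‖`, so `φ` decreases.
    let φ : E → ℝ := fun z => b * ‖F z - F y‖ + ‖z - x‖
    have hφ : ContinuousOn φ (Metric.closedBall x R) := by
      intro z hz
      have := (hF z (hsub hz)).continuousAt
      exact ContinuousAt.continuousWithinAt (by fun_prop)
    obtain ⟨z, hz, hmin⟩ := (isCompact_closedBall x R).exists_isMinOn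
      ⟨x, Metric.mem_closedBall_self hR0⟩ hφ
    have hzx : b * ‖F z - F y‖ + ‖z - x‖ ≤ b * ‖F y - F x‖ := by
      have := hmin (Metric.mem_closedBall_self hR0)
      simpa [φ, norm_sub_rev (F x)] using this
    have hzU := hsub hz
    by_cases hFz : F z = F y
    · have := hinj hzU hy hFz
      subst this
      simpa using hzx
    exfalso
    have ha : 0 < ‖F z - F y‖ := norm_pos_iff.2 (sub_ne_zero.2 hFz)
    have hzR : ‖z - x‖ < R := by nlinarith
    have hI := ContinuousLinearMap.isInvertible_of_norm_le (hinv z hzU)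
    set d := (fderiv ℝ F z).inverse (F y - F z) with hd
    have hd1 : fderiv ℝ F z d = F y - F z := hI.self_apply_inverse _
    have hd2 : ‖d‖ ≤ c * ‖F z - F y‖ := by
      have := hinv z hzU d
      rwa [hd1, norm_sub_rev] at this
    have h1 : HasDerivAt (fun t : ℝ => z + t • d) d 0 := by
      simpa using ((hasDerivAt_id (0 : ℝ)).smul_const d).const_add z
    have h2 : HasDerivAt (fun t : ℝ => F (z + t • d)) (F y - F z) 0 := by
      have := (show DifferentiableAt ℝ F (z + (0 : ℝ) • d) by
        simpa using hF z hzU).hasFDerivAt.comp_hasDerivAt 0 h1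
      simpa [hd1, Function.comp_def] using this
    -- The linearization error `η` costs half of the gain `(b - c) ‖F z - F y‖`.
    have hη : 0 < (b - c) * ‖F z - F y‖ / (2 * b) := by
      have := sub_pos.2 hb
      positivity
    have hbη : b * ((b - c) * ‖F z - F y‖ / (2 * b)) < (b - c) * ‖F z - F y‖ := by
      have := mul_pos (sub_pos.2 hb) ha
      field_simp
      linarith
    set η := (b - c) * ‖F z - F y‖ / (2 * b)
    have h3 := ((hasDerivAt_iff_isLittleO.1 h2).def hη).filter_mono
      (nhdsWithin_le_nhds (s := Set.Ioi 0))
    have h4 : ∀ᶠ t in 𝓝[>] (0 : ℝ), z + t • d ∈ Metric.closedBall x R := by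
      have : ∀ᶠ t in 𝓝 (0 : ℝ), z + t • d ∈ Metric.ball x R := by
        refine h1.continuousAt.eventually (Metric.isOpen_ball.mem_nhds ?_)
        simpa [dist_eq_norm] using hzR
      exact (this.filter_mono nhdsWithin_le_nhds).mono fun _ h => Metric.ball_subset_closedBall h
    have h5 : ∀ᶠ t in 𝓝[>] (0 : ℝ), t ∈ Set.Ioo (0 : ℝ) 1 := Ioo_mem_nhdsGT zero_lt_one
    obtain ⟨t, ht3, ht4, ht0, ht1⟩ := (h3.and (h4.and h5)).exists
    have hle : φ z ≤ φ (z + t • d) := hmin ht4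
    simp only [zero_smul, add_zero, sub_zero, Real.norm_eq_abs, abs_of_pos ht0] at ht3
    have e1 : ‖F (z + t • d) - F y‖ ≤ (1 - t) * ‖F z - F y‖ + η * t := by
      have : F (z + t • d) - F y =
          (1 - t) • (F z - F y) + (F (z + t • d) - F z - t • (F y - F z)) := by module
      rw [this]
      refine (norm_add_le _ _).trans (add_le_add ?_ ht3)
      rw [norm_smul, Real.norm_eq_abs, abs_of_pos (by linarith)]
    have e2 : ‖z + t • d - x‖ ≤ ‖z - x‖ + t * (c * ‖F z - F y‖) := by
      have : z + t • d - x = (z - x) + t • d := by abel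
      rw [this]
      refine (norm_add_le _ _).trans (add_le_add le_rfl ?_)
      rw [norm_smul, Real.norm_eq_abs, abs_of_pos ht0]
      gcongr
    have e3 : b * ‖F z - F y‖ + ‖z - x‖ ≤
        b * ((1 - t) * ‖F z - F y‖ + η * t) + (‖z - x‖ + t * (c * ‖F z - F y‖)) :=
      hle.trans (add_le_add (mul_le_mul_of_nonneg_left e1 hb0.le) e2)
    nlinarith
  -- Let `b` decrease to `c`.
  by_contra hcon
  push Not at hcon
  have ht : Tendsto (fun b => b * ‖F y - F x‖) (𝓝[>] c) (𝓝 (c * ‖F y - F x‖)) :=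
    ((continuous_id.mul continuous_const).tendsto c).mono_left nhdsWithin_le_nhds
  have := (ht.eventually (gt_mem_nhds hxy)).and ((ht.eventually (gt_mem_nhds hcon)).and
    self_mem_nhdsWithin)
  obtain ⟨b, h1, h2, h3⟩ := this.exists
  exact absurd (key b h3 h1) (not_le.2 h2)

/-- Continuity of a solution `T` of the perturbed equation `F (T v) = s • h (T v) + e v`. -/
theorem continuousAt_of_perturbed_equation {X : Type*} [TopologicalSpace X] {U : Set E}
    (hU : Convex ℝ U) {F h : E → E} (hF : ∀ x ∈ U, DifferentiableAt ℝ F x)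
    (hpos : ∀ x ∈ U, ∀ v : E, v ≠ 0 → 0 < inner ℝ v (fderiv ℝ F x v))
    {c r K s : ℝ} (hinv : ∀ x ∈ U, ∀ u, ‖u‖ ≤ c * ‖fderiv ℝ F x u‖) (hc : 0 ≤ c)
    (hh : ∀ x ∈ U, DifferentiableAt ℝ h x) (hhK : ∀ x ∈ U, ‖h x‖ ≤ K)
    (hhK' : ∀ x ∈ U, ‖fderiv ℝ h x‖ ≤ K) (hs : |s| * c * K ≤ 1 / 2)
    (hsr : 2 * (|s| * c * K) < r) {T : X → E} {e : X → E} {x₀ : X}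
    (hT : ∀ᶠ v in 𝓝 x₀, T v ∈ U) (hball : Metric.ball (T x₀) r ⊆ U)
    (heq : ∀ᶠ v in 𝓝 x₀, F (T v) = s • h (T v) + e v) (he : Tendsto e (𝓝 x₀) (𝓝 0))
    (he₀ : e x₀ = 0) : ContinuousAt T x₀ := by
  have heq₀ : F (T x₀) = s • h (T x₀) := by simpa [he₀] using heq.self_of_nhds
  have hT₀ : T x₀ ∈ U := hT.self_of_nhds
  have hlim : Tendsto (fun v => 2 * (|s| * c * K) + c * ‖e v‖) (𝓝 x₀)
      (𝓝 (2 * (|s| * c * K))) := by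
    have := (he.norm.const_mul c).const_add (2 * (|s| * c * K))
    simpa using this
  have hbound : ∀ᶠ v in 𝓝 x₀, ‖T v - T x₀‖ ≤ 2 * c * ‖e v‖ := by
    filter_upwards [hT, heq, hlim.eventually (gt_mem_nhds hsr)] with v hv hve hvr
    have hdiff : F (T v) - F (T x₀) = s • (h (T v) - h (T x₀)) + e v := by
      rw [hve, heq₀]; module
    have hn : ‖F (T v) - F (T x₀)‖ ≤ |s| * ‖h (T v) - h (T x₀)‖ + ‖e v‖ := by
      rw [hdiff]
      refine (norm_add_le _ _).trans (add_le_add ?_ le_rfl)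
      rw [norm_smul, Real.norm_eq_abs]
    -- The crude bound `2 K` only makes the quantitative inverse applicable. The Lipschitz bound is
    -- then used to absorb half of `‖T v - T x₀‖` into the left side.
    have h2K : ‖h (T v) - h (T x₀)‖ ≤ 2 * K :=
      (norm_sub_le _ _).trans (by linarith [hhK _ hv, hhK _ hT₀])
    have hLip : ‖h (T v) - h (T x₀)‖ ≤ K * ‖T v - T x₀‖ :=
      hU.norm_image_sub_le_of_norm_fderiv_le hh hhK' hT₀ hv
    have hsc : 0 ≤ c * |s| := mul_nonneg hc (abs_nonneg s)
    have hclose : c * ‖F (T v) - F (T x₀)‖ < r := by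
      refine lt_of_le_of_lt ?_ hvr
      have := mul_le_mul_of_nonneg_left hn hc
      have := mul_le_mul_of_nonneg_left h2K hsc
      nlinarith
    have hmain := norm_sub_le_of_inner_fderiv_pos hU hF hpos hinv hc hball hv hclose
    have h3 := mul_le_mul_of_nonneg_left hn hc
    have h4 := mul_le_mul_of_nonneg_left hLip hsc
    have h5 := mul_le_mul_of_nonneg_right hs (norm_nonneg (T v - T x₀))
    nlinarith
  rw [ContinuousAt, tendsto_iff_norm_sub_tendsto_zero]
  refine squeeze_zero' (Eventually.of_forall fun _ => norm_nonneg _) hbound ?_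
  simpa using he.norm.const_mul (2 * c)

end QuantitativeInverse

/-! ### Smoothness from the implicit function theorem -/

section ImplicitContDiff

variable {E X : Type*} [NormedAddCommGroup E] [NormedSpace ℝ E] [CompleteSpace E]
  [NormedAddCommGroup X] [NormedSpace ℝ X] [CompleteSpace X]

/-- A continuous solution of a smooth equation with invertible partial derivative is smooth. -/
theorem ContDiffAt.of_implicit_equation {n : WithTop ℕ∞} (hn : n ≠ 0) {Φ : X × E → E} {T : X → E}
    {x₀ : X} (hΦ : ContDiffAt ℝ n Φ (x₀, T x₀)) (hT : ContinuousAt T x₀)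
    (heq : ∀ᶠ v in 𝓝 x₀, Φ (v, T v) = 0)
    (hinv : (fderiv ℝ (fun θ => Φ (x₀, θ)) (T x₀)).IsInvertible) : ContDiffAt ℝ n T x₀ := by
  have hpart : fderiv ℝ Φ (x₀, T x₀) ∘L .inr ℝ X E = fderiv ℝ (fun θ => Φ (x₀, θ)) (T x₀) := by
    have h := (hΦ.differentiableAt hn).hasFDerivAt.comp (T x₀) (hasFDerivAt_prodMk_right x₀ (T x₀))
    exact h.fderiv.symm
  rw [← hpart] at hinv
  refine (hΦ.contDiffAt_implicitFunction hn hinv).congr_of_eventuallyEq ?_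
  have h := hΦ.eventually_apply_eq_iff_implicitFunction hn hinv
  have hc : Tendsto (fun v => (v, T v)) (𝓝 x₀) (𝓝 (x₀, T x₀)) := continuousAt_id.prodMk hT
  filter_upwards [hc.eventually h, heq] with v hv hv0
  exact (hv.1 (hv0.trans heq.self_of_nhds.symm)).symm

end ImplicitContDiff

/-! ### From arrays of partial derivatives to operator norms -/

section Arrays

variable {D : ℕ}

theorem EuclideanSpace.sum_smul_single (x : EuclideanSpace ℝ (Fin D)) :
    ∑ j, x j • EuclideanSpace.single j (1 : ℝ) = x := by
  ext j
  simp [Pi.single_apply]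

theorem EuclideanSpace.norm_le_card_mul {x : EuclideanSpace ℝ (Fin D)} {b : ℝ}
    (h : ∀ j, |x j| ≤ b) : ‖x‖ ≤ D * b := by
  conv_lhs => rw [← EuclideanSpace.sum_smul_single x]
  refine (norm_sum_le _ _).trans ((Finset.sum_le_sum (g := fun _ => b) fun j _ => ?_).trans ?_)
  · rw [norm_smul]
    simpa using h j
  · simp

theorem ContinuousMultilinearMap.norm_le_of_single {k : ℕ}
    (T : ContinuousMultilinearMap ℝ (fun _ : Fin k => EuclideanSpace ℝ (Fin D))
      (EuclideanSpace ℝ (Fin D))) {b : ℝ} (hb : 0 ≤ b)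
    (h : ∀ (d : Fin k → Fin D) (j : Fin D),
      |T (fun l => EuclideanSpace.single (d l) (1 : ℝ)) j| ≤ b) :
    ‖T‖ ≤ D ^ k * (D * b) := by
  refine T.opNorm_le_bound (by positivity) fun v => ?_
  have hv : T v = ∑ d : Fin k → Fin D, (∏ l, v l (d l)) •
      T (fun l => EuclideanSpace.single (d l) (1 : ℝ)) := by
    conv_lhs => rw [show v = fun l => ∑ j, v l j • EuclideanSpace.single j (1 : ℝ) from
      funext fun l => (EuclideanSpace.sum_smul_single (v l)).symm]
    rw [T.map_sum]
    refine Finset.sum_congr rfl fun d _ => ?_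
    rw [T.map_smul_univ]
  rw [hv]
  refine (norm_sum_le _ _).trans ((Finset.sum_le_sum
    (g := fun _ => (∏ l, ‖v l‖) * (D * b)) fun d _ => ?_).trans ?_)
  · rw [norm_smul, norm_prod]
    gcongr with l
    · exact PiLp.norm_apply_le (v l) (d l)
    · exact EuclideanSpace.norm_le_card_mul (h d)
  · simp
    ring_nf
    rfl

namespace HOIJ

theorem abs_le_norm2 {ι : Type*} [Fintype ι] (a : ι → ℝ) (p : ι) : |a p| ≤ norm2 a :=
  Real.abs_le_sqrt (Finset.single_le_sum (f := fun i => a i ^ 2) (fun _ _ => sq_nonneg _)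
    (Finset.mem_univ p))

/-- One constant serves all orders up to `n`; the base `D + 1` is at least one even if `D = 0`. -/
theorem norm_iteratedFDeriv_le_of_derivArray {k n : ℕ} (hk : k ≤ n) {f : Param D → Param D}
    {θ : Param D} {b : ℝ} (hb : 0 ≤ b) (h : ∀ p, |derivArray k f θ p| ≤ b) :
    ‖iteratedFDeriv ℝ k f θ‖ ≤ (D + 1) ^ (n + 1) * b := by
  refine (ContinuousMultilinearMap.norm_le_of_single _ hb fun d j => h (d, j)).trans ?_
  rw [← mul_assoc, ← pow_succ]
  gcongr
  calc (D : ℝ) ^ (k + 1) ≤ (D + 1) ^ (k + 1) := by gcongr; linarith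
    _ ≤ (D + 1) ^ (n + 1) := pow_le_pow_right₀ (by linarith [(Nat.cast_nonneg D : (0:ℝ) ≤ D)])
      (by omega)

end HOIJ

end Arrays

/-! ### Directional derivatives and Taylor's formula -/

section LineDeriv

variable {X E : Type*} [NormedAddCommGroup X] [NormedSpace ℝ X] [NormedAddCommGroup E]
  [NormedSpace ℝ E]

theorem iteratedDeriv_comp_line {n : ℕ} {f : X → E} {x : X} (hf : ContDiffAt ℝ n f x) (v : X) :
    iteratedDeriv n (fun t : ℝ => f (x + t • v)) 0 = iteratedFDeriv ℝ n f x (fun _ => v) := by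
  have h0 : ContDiffAt ℝ n (fun z => f (x + z)) 0 :=
    ContDiffAt.comp (0 : X) (by simpa using hf) (by fun_prop)
  obtain ⟨u, huo, hu0, hu⟩ := h0.exists_isOpen_contDiffOn
  let L : ℝ →L[ℝ] X := ContinuousLinearMap.toSpanSingleton ℝ v
  have hpre : IsOpen (L ⁻¹' u) := huo.preimage L.continuous
  have hmem : (0 : ℝ) ∈ L ⁻¹' u := by simpa using hu0
  have h := L.iteratedFDerivWithin_comp_right hu huo.uniqueDiffOn hpre.uniqueDiffOn
    (x := (0 : ℝ)) (by simpa using hu0) (i := n) le_rfl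
  rw [iteratedFDerivWithin_of_isOpen _ hpre hmem, iteratedFDerivWithin_of_isOpen _ huo
    (by simpa using hu0), iteratedFDeriv_comp_add_left] at h
  rw [iteratedDeriv_eq_iteratedFDeriv]
  have h' := congrArg (fun T => T (fun _ : Fin n => (1 : ℝ))) h
  simpa [L, Function.comp_def] using h'

end LineDeriv

section Taylor

variable {E : Type*} [NormedAddCommGroup E] [NormedSpace ℝ E]

theorem norm_taylor_sub_le {f : ℝ → E} {b B : ℝ} (hb : 0 < b) {n : ℕ}
    (hf : ∀ t ∈ Set.Icc 0 b, ContDiffAt ℝ (n + 1 : ℕ) f t)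
    (hB : ∀ t ∈ Set.Icc 0 b, ‖iteratedFDeriv ℝ (n + 1) f t‖ ≤ B) :
    ‖f 0 + ∑ k ∈ Finset.Icc 1 n, (1 / (k.factorial : ℝ)) • b ^ k • iteratedDeriv k f 0 - f b‖ ≤
      B * b ^ (n + 1) := by
  have h := taylor_mean_remainder_bound (f := f) (a := 0) (b := b) (x := b) (C := B) (n := n)
    hb.le (fun t ht => by exact_mod_cast (hf t ht).contDiffWithinAt) ⟨hb.le, le_rfl⟩
    (fun t ht => by
      rw [iteratedDerivWithin_eq_iteratedDeriv (uniqueDiffOn_Icc hb) (hf t ht) ht,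
        ← norm_iteratedFDeriv_eq_norm_iteratedDeriv]
      exact hB t ht)
  have h0 : (0 : ℝ) ∈ Set.Icc 0 b := ⟨le_rfl, hb.le⟩
  have hB0 : 0 ≤ B := (norm_nonneg _).trans (hB 0 h0)
  have he : taylorWithinEval f n (Set.Icc 0 b) 0 b =
      f 0 + ∑ k ∈ Finset.Icc 1 n, (1 / (k.factorial : ℝ)) • b ^ k • iteratedDeriv k f 0 := by
    rw [taylor_within_apply, Finset.range_eq_Ico, Finset.sum_eq_sum_Ico_succ_bot (by omega)]
    congr 1
    · simp
    · refine Finset.sum_congr (by ext k; simp) fun k hk => ?_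
      have hk' : k ≤ n + 1 := by simp at hk; omega
      rw [iteratedDerivWithin_eq_iteratedDeriv (uniqueDiffOn_Icc hb)
        ((hf 0 h0).of_le (by exact_mod_cast hk')) h0, smul_smul]
      simp
  rw [he, norm_sub_rev, sub_zero] at h
  refine h.trans (div_le_self (by positivity) ?_)
  exact_mod_cast Nat.one_le_iff_ne_zero.2 (Nat.factorial_ne_zero n)

end Taylor

/-! ### The deterministic error bound -/

namespace HOIJ

variable {D N : ℕ}

theorem isOpen_wDom (ρ : ℝ) (w : Weight N) : IsOpen (wDom ρ w) := by
  have : wDom ρ w = ⋃ t ∈ Set.Icc (0 : ℝ) 1, {v | ‖v - ((1 - t) • ones N + t • w)‖ < ρ} := by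
    ext v; simp [wDom]
  rw [this]
  exact isOpen_biUnion fun t _ => isOpen_lt (by fun_prop) continuous_const

theorem line_mem_wDom {ρ : ℝ} (hρ : 0 < ρ) (w : Weight N) {t : ℝ} (ht : t ∈ Set.Icc (0 : ℝ) 1) :
    ones N + t • (w - ones N) ∈ wDom ρ w := by
  refine ⟨t, ht, ?_⟩
  have : ones N + t • (w - ones N) - ((1 - t) • ones N + t • w) = 0 := by module
  rwa [this, norm_zero]

theorem ones_apply (j : Fin N) : ones N j = 1 := rfl

theorem line_loo_apply (i j : Fin N) (t : ℝ) :
    (ones N + t • (loo N i - ones N)) j = 1 - if j = i then t else 0 := by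
  have : loo N i j = if j = i then 0 else 1 := rfl
  simp only [PiLp.add_apply, PiLp.smul_apply, PiLp.sub_apply, ones_apply, this, smul_eq_mul]
  split_ifs <;> ring

theorem G_line_loo (g : ℕ → Param D → Param D) (i : Fin N) (t : ℝ) (θ : Param D) :
    G g N θ (ones N + t • (loo N i - ones N)) =
      G g N θ (ones N) - (t / N) • g (i + 1) θ := by
  have h : ∀ j : Fin N, (ones N + t • (loo N i - ones N)) j • g (j + 1) θ =
      ones N j • g (j + 1) θ - if j = i then t • g (i + 1) θ else 0 := by
    intro j
    rw [line_loo_apply, ones_apply]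
    split_ifs with h
    · subst h; module
    · simp
  simp only [G, h, Finset.sum_sub_distrib, Finset.sum_ite_eq', Finset.mem_univ, if_true]
  module

theorem G_sub_G (g : ℕ → Param D → Param D) (θ : Param D) (v w : Weight N) :
    G g N θ v - G g N θ w = (1 / (N : ℝ)) • ∑ j : Fin N, (v j - w j) • g (j + 1) θ := by
  simp only [G, sub_smul, Finset.sum_sub_distrib]
  module

theorem contDiffAt_G {n : WithTop ℕ∞} {g : ℕ → Param D → Param D} {θ : Param D} {v : Weight N}
    (hg : ∀ j, ContDiffAt ℝ n (g j) θ) :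
    ContDiffAt ℝ n (fun p : Weight N × Param D => G g N p.2 p.1) (v, θ) := by
  have hsnd : ∀ j, ContDiffAt ℝ n (fun p : Weight N × Param D => g j p.2) (v, θ) := fun j =>
    ContDiffAt.comp (v, θ) (hg j) contDiffAt_snd
  refine ContDiffAt.const_smul (1 / (N : ℝ)) ((hsnd 0).add (ContDiffAt.sum fun j _ => ?_))
  refine ContDiffAt.smul (f := fun p : Weight N × Param D => p.1 j) ?_ (hsnd _)
  fun_prop

/-- Positive definiteness gives injectivity, hence invertibility, so `inverse` is not its default
value `0` and the bound on its norm has content. -/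
theorem Convexity.norm_le {g : ℕ → Param D → Param D} {Ωθ : Set (Param D)} {c : ℝ}
    (h : Convexity g Ωθ N c) {θ : Param D} (hθ : θ ∈ Ωθ) (u : Param D) :
    ‖u‖ ≤ c * ‖fderiv ℝ (fun η => G g N η (ones N)) θ u‖ := by
  obtain ⟨hpos, hc⟩ := h θ hθ
  have hI : (H g N θ (ones N)).IsInvertible := by
    refine ContinuousLinearMap.isInvertible_of_injective
      ((injective_iff_map_eq_zero _).2 fun v hv => ?_)
    by_contra hne
    have := hpos v hne
    rw [hv, inner_zero_right] at this
    exact lt_irrefl _ this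
  have h1 := (H g N θ (ones N)).inverse.le_of_opNorm_le hc (H g N θ (ones N) u)
  rwa [hI.inverse_apply_self] at h1

/-- The deterministic error bound: the constants depend only on bounds for the inverse of the
Hessian, for the derivatives of the estimating equation at `1_N` and for those of the term left
out. -/
theorem exists_errIJ_le (D kIJ : ℕ) {r : ℝ} (hr : 0 < r) {c m : ℝ} (hc : 0 ≤ c) (hm : 0 ≤ m) :
    ∃ (C : ℝ) (N₀ : ℕ), ∀ N ≥ N₀, ∀ (g : ℕ → Param D → Param D) (Ωθ : Set (Param D)) (ρ : ℝ)
      (that : Weight N → Param D) (i : Fin N), 0 < ρ →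
      ThetaDom g Ωθ r ρ that (loo N i) → Diffable g Ωθ kIJ → Convexity g Ωθ N c →
      Bounded g Ωθ kIJ N (fun _ => m) → SupTerms g Ωθ kIJ →
      (∀ k ≤ kIJ + 1, ∀ θ ∈ Ωθ, ‖derivArray k (g (i + 1)) θ‖ ≤ m) →
      ContDiffAt ℝ kIJ that (ones N) ∧
        errIJ that kIJ (loo N i) ≤ C / (N : ℝ) ^ (kIJ + 1) := by
  set m' : ℝ := (D + 1) ^ (kIJ + 1 + 1) * m with hm'
  have hm'0 : 0 ≤ m' := by positivity
  obtain ⟨B, hB1, hB⟩ := exists_bound_iteratedFDeriv_implicit_curve (Param D) (2 * c) m' (kIJ + 1)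
  -- For such `N` both `c m' / N ≤ 1/2` and `2 c m' / N < r`: the perturbation at most doubles the
  -- bound for the inverse, and solutions stay within reach of the radius `r`.
  refine ⟨B, ⌈2 * (c * m') + 2 * (c * m') / r⌉₊ + 1, ?_⟩
  intro N hN g Ωθ ρ that i hρ hdom hdiff hconv hbdd hsup hterm
  obtain ⟨hsol, hopen, hthick⟩ := hdom
  have hN1 : (1 : ℝ) ≤ N := by exact_mod_cast (by omega : 1 ≤ N)
  have hN0 : (0 : ℝ) < N := by linarith
  have hNc : 2 * (c * m') + 2 * (c * m') / r < N := by
    have h1 := Nat.le_ceil (2 * (c * m') + 2 * (c * m') / r)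
    have h2 : ((⌈2 * (c * m') + 2 * (c * m') / r⌉₊ + 1 : ℕ) : ℝ) ≤ N := by exact_mod_cast hN
    push_cast at h2
    linarith
  have hcm : 0 ≤ c * m' := mul_nonneg hc hm'0
  have hsmall : ∀ s : ℝ, 0 ≤ s → s ≤ 1 / N → |s| * c * m' ≤ 1 / 2 ∧ 2 * (|s| * c * m') < r := by
    intro s hs0 hs1
    have hle : |s| * c * m' ≤ c * m' / N := by
      rw [abs_of_nonneg hs0, mul_assoc]
      calc s * (c * m') ≤ 1 / N * (c * m') := by gcongr
        _ = _ := by ring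
    have hr1 : 0 ≤ 2 * (c * m') / r := by positivity
    constructor
    · refine hle.trans ?_
      rw [div_le_iff₀ hN0]
      linarith
    · refine lt_of_le_of_lt (mul_le_mul_of_nonneg_left hle zero_le_two) ?_
      rw [← mul_div_assoc, div_lt_iff₀ hN0, ← div_lt_iff₀' hr]
      linarith
  -- Unlike `Ωθ`, the set `U` is known to be convex, as the monotonicity and mean value arguments
  -- need.
  set U := Metric.thickening r (convexHull ℝ (that '' wDom ρ (loo N i))) with hU
  have hUconv : Convex ℝ U := (convex_convexHull ℝ _).thickening r
  have hball : ∀ v ∈ wDom ρ (loo N i), Metric.ball (that v) r ⊆ U := fun v hv =>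
    Metric.ball_subset_thickening (subset_convexHull ℝ _ (Set.mem_image_of_mem that hv)) r
  have hTU : ∀ v ∈ wDom ρ (loo N i), that v ∈ U := fun v hv =>
    hball v hv (Metric.mem_ball_self hr)
  set F : Param D → Param D := fun η => G g N η (ones N) with hF
  set h : Param D → Param D := g (i + 1) with hh
  have hgC : ∀ j, ∀ θ ∈ Ωθ, ContDiffAt ℝ (kIJ + 1 : ℕ) (g j) θ := fun j θ hθ =>
    (hdiff j).contDiffAt (hopen.mem_nhds hθ)
  have hFC : ∀ θ ∈ Ωθ, ContDiffAt ℝ (kIJ + 1 : ℕ) F θ := fun θ hθ =>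
    ContDiffAt.comp (g := fun p : Weight N × Param D => G g N p.2 p.1)
      (f := fun η => (ones N, η)) θ (contDiffAt_G fun j => hgC j θ hθ) (by fun_prop)
  have hk0 : ((kIJ + 1 : ℕ) : WithTop ℕ∞) ≠ 0 := by exact_mod_cast Nat.succ_ne_zero kIJ
  have hFd : ∀ θ ∈ U, DifferentiableAt ℝ F θ := fun θ hθ =>
    (hFC θ (hthick hθ)).differentiableAt hk0
  have hhd : ∀ θ ∈ U, DifferentiableAt ℝ h θ := fun θ hθ =>
    (hgC _ θ (hthick hθ)).differentiableAt hk0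
  have hFm : ∀ θ ∈ Ωθ, ∀ j, 1 ≤ j → j ≤ kIJ + 1 → ‖iteratedFDeriv ℝ j F θ‖ ≤ m' :=
    fun θ hθ j h1 h2 => norm_iteratedFDeriv_le_of_derivArray h2 hm fun p =>
      (abs_le_norm2 _ p).trans (hbdd j h1 h2 θ hθ)
  have hhm : ∀ θ ∈ Ωθ, ∀ j ≤ kIJ + 1, ‖iteratedFDeriv ℝ j h θ‖ ≤ m' :=
    fun θ hθ j h2 => norm_iteratedFDeriv_le_of_derivArray h2 hm fun p =>
      (norm_le_pi_norm (derivArray j (g (i + 1)) θ) p).trans (hterm j h2 θ hθ)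
  have hhm0 : ∀ θ ∈ Ωθ, ‖h θ‖ ≤ m' := fun θ hθ => by simpa using hhm θ hθ 0 (by omega)
  have hhm1 : ∀ θ ∈ Ωθ, ‖fderiv ℝ h θ‖ ≤ m' := fun θ hθ => by
    simpa using hhm θ hθ 1 (by omega)
  have hpos : ∀ θ ∈ U, ∀ v : Param D, v ≠ 0 → 0 < inner ℝ v (fderiv ℝ F θ v) := fun θ hθ =>
    (hconv θ (hthick hθ)).1
  have hFinv : ∀ θ ∈ U, ∀ u, ‖u‖ ≤ c * ‖fderiv ℝ F θ u‖ := fun θ hθ u =>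
    hconv.norm_le (hthick hθ) u
  have hAinv : ∀ θ ∈ U, ∀ s : ℝ, 0 ≤ s → s ≤ 1 / N → ∀ u,
      ‖u‖ ≤ 2 * c * ‖(fderiv ℝ F θ - s • fderiv ℝ h θ) u‖ := by
    intro θ hθ s hs0 hs1 u
    have h1 := hFinv θ hθ u
    have h2 : fderiv ℝ F θ u = (fderiv ℝ F θ - s • fderiv ℝ h θ) u + s • fderiv ℝ h θ u := by
      simp
    have h3 : ‖s • fderiv ℝ h θ u‖ ≤ |s| * (m' * ‖u‖) := by
      rw [norm_smul, Real.norm_eq_abs]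
      gcongr
      exact (fderiv ℝ h θ).le_of_opNorm_le (hhm1 θ (hthick hθ)) u
    have h4 : ‖fderiv ℝ F θ u‖ ≤
        ‖(fderiv ℝ F θ - s • fderiv ℝ h θ) u‖ + |s| * (m' * ‖u‖) := by
      conv_lhs => rw [h2]
      exact (norm_add_le _ _).trans (add_le_add le_rfl h3)
    have h5 := mul_le_mul_of_nonneg_right (hsmall s hs0 hs1).1 (norm_nonneg u)
    have h6 := mul_le_mul_of_nonneg_left h4 hc
    nlinarith
  set ℓ : ℝ → Weight N := fun t => ones N + t • (loo N i - ones N) with hℓ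
  have hℓmem : ∀ t ∈ Set.Icc (0 : ℝ) 1, ℓ t ∈ wDom ρ (loo N i) := fun t ht =>
    line_mem_wDom hρ _ ht
  have hdom_nhds : ∀ t ∈ Set.Icc (0 : ℝ) 1, ∀ᶠ v in 𝓝 (ℓ t), v ∈ wDom ρ (loo N i) :=
    fun t ht => (isOpen_wDom ρ _).mem_nhds (hℓmem t ht)
  have htN : ∀ t ∈ Set.Icc (0 : ℝ) 1, 0 ≤ t / N ∧ t / N ≤ 1 / N := fun t ht =>
    ⟨div_nonneg ht.1 hN0.le, div_le_div_of_nonneg_right ht.2 hN0.le⟩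
  have hcont : ∀ t ∈ Set.Icc (0 : ℝ) 1, ContinuousAt that (ℓ t) := by
    intro t ht
    -- These bounds may depend on `j` and `N`: they serve only for continuity and do not enter the
    -- constant.
    have hbd : ∀ j : Fin N, ∃ b : ℝ, ∀ θ ∈ Ωθ, ‖g (j + 1) θ‖ ≤ b := by
      intro j
      obtain ⟨b, hb⟩ := hsup 0 (by omega) (j + 1) (by omega)
      refine ⟨(D + 1) ^ (0 + 1) * |b|, fun θ hθ => ?_⟩
      have := norm_iteratedFDeriv_le_of_derivArray (le_refl 0) (abs_nonneg b) (f := g (j + 1))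
        (θ := θ) fun p => (norm_le_pi_norm (derivArray 0 (g (j + 1)) θ) p).trans
          ((hb ⟨θ, hθ, rfl⟩).trans (le_abs_self b))
      simpa using this
    choose b hb using hbd
    let e : Weight N → Param D := fun v =>
      -((1 / (N : ℝ)) • ∑ j : Fin N, (v j - ℓ t j) • g (j + 1) (that v))
    have he : Tendsto e (𝓝 (ℓ t)) (𝓝 0) := by
      have hlim : Tendsto (fun v : Weight N => (1 / (N : ℝ)) * ∑ j : Fin N, |v j - ℓ t j| * b j)
          (𝓝 (ℓ t)) (𝓝 0) := by
        have hcts : Continuous (fun v : Weight N =>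
            (1 / (N : ℝ)) * ∑ j : Fin N, |v j - ℓ t j| * b j) := by fun_prop
        simpa using hcts.tendsto (ℓ t)
      refine squeeze_zero_norm' ?_ hlim
      filter_upwards [hdom_nhds t ht] with v hv
      rw [norm_neg, norm_smul, Real.norm_eq_abs, abs_of_nonneg (by positivity)]
      gcongr
      refine (norm_sum_le _ _).trans (Finset.sum_le_sum fun j _ => ?_)
      rw [norm_smul, Real.norm_eq_abs]
      gcongr
      exact hb j _ (hthick (hTU v hv))
    obtain ⟨hs0, hs1⟩ := htN t ht
    refine continuousAt_of_perturbed_equation (s := t / N) (e := e) hUconv hFd hpos hFinv hc hhd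
      (fun θ hθ => hhm0 θ (hthick hθ)) (fun θ hθ => hhm1 θ (hthick hθ))
      (hsmall _ hs0 hs1).1 (hsmall _ hs0 hs1).2 ((hdom_nhds t ht).mono hTU)
      (hball _ (hℓmem t ht)) ?_ he (by simp [e])
    filter_upwards [hdom_nhds t ht] with v hv
    have h1 := G_sub_G g (that v) v (ℓ t)
    rw [hsol v hv, G_line_loo, zero_sub] at h1
    simp only [e, ← h1, neg_neg, hF, hh]
    abel
  have hsmooth : ∀ t ∈ Set.Icc (0 : ℝ) 1, ContDiffAt ℝ (kIJ + 1 : ℕ) that (ℓ t) := by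
    intro t ht
    have hU' := hTU _ (hℓmem t ht)
    refine ContDiffAt.of_implicit_equation hk0 (Φ := fun p : Weight N × Param D => G g N p.2 p.1)
      (contDiffAt_G fun j => hgC j _ (hthick hU')) (hcont t ht)
      ((hdom_nhds t ht).mono fun v hv => hsol v hv) ?_
    have h1 : (fun θ => G g N θ (ℓ t)) = fun θ => F θ - (t / N) • h θ :=
      funext fun θ => G_line_loo g i t θ
    change (fderiv ℝ (fun θ => G g N θ (ℓ t)) (that (ℓ t))).IsInvertible
    have h2 : HasFDerivAt (fun θ => F θ - (t / N) • h θ)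
        (fderiv ℝ F (that (ℓ t)) - (t / (N : ℝ)) • fderiv ℝ h (that (ℓ t))) (that (ℓ t)) :=
      (hFd _ hU').hasFDerivAt.fun_sub ((hhd _ hU').hasFDerivAt.fun_const_smul (t / (N : ℝ)))
    rw [h1, h2.fderiv]
    exact ContinuousLinearMap.isInvertible_of_norm_le
      (hAinv _ hU' _ (htN t ht).1 (htN t ht).2)
  -- After rescaling, the equation `F (Θ s) = s • h (Θ s)` has no explicit factor `N`, and the time
  -- interval has length `1 / N`.
  set Θ : ℝ → Param D := fun s => that (ℓ (s * N)) with hΘ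
  have hsN : ∀ s ∈ Set.Icc (0 : ℝ) (1 / N), s * N ∈ Set.Icc (0 : ℝ) 1 := fun s hs =>
    ⟨mul_nonneg hs.1 hN0.le, by rw [← le_div_iff₀ hN0]; exact hs.2⟩
  have hΘC : ∀ s ∈ Set.Icc (0 : ℝ) (1 / N), ContDiffAt ℝ (kIJ + 1 : ℕ) Θ s := fun s hs =>
    ContDiffAt.comp (g := that) (f := fun s : ℝ => ℓ (s * N)) s (hsmooth _ (hsN s hs))
      (by simp only [hℓ]; fun_prop)
  have hΘB : ∀ s ∈ Set.Icc (0 : ℝ) (1 / N), ‖iteratedFDeriv ℝ (kIJ + 1) Θ s‖ ≤ B := by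
    intro s hs
    have hU' := hTU _ (hℓmem _ (hsN s hs))
    have hΩ := hthick hU'
    refine hB F h Θ s ?_ ?_ (hFC _ hΩ) (hgC _ _ hΩ) (hΘC s hs) (hFm _ hΩ) (hhm _ hΩ)
      (hAinv _ hU' s hs.1 hs.2) (kIJ + 1) (by omega) le_rfl
    · rw [abs_of_nonneg hs.1]
      exact hs.2.trans ((div_le_one hN0).2 hN1)
    · have hc' : ContinuousAt (fun s : ℝ => ℓ (s * N)) s := by
        simp only [hℓ]; fun_prop
      filter_upwards [hc'.eventually (hdom_nhds _ (hsN s hs))] with t ht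
      have h1 := hsol _ ht
      rw [G_line_loo, sub_eq_zero, mul_div_cancel_right₀ _ hN0.ne'] at h1
      exact h1
  have hℓ0 : ℓ 0 = ones N := by simp [hℓ]
  have hones : ContDiffAt ℝ (kIJ + 1 : ℕ) that (ones N) := by
    simpa [hℓ0] using hsmooth 0 ⟨le_rfl, zero_le_one⟩
  refine ⟨hones.of_le (by exact_mod_cast Nat.le_succ kIJ), ?_⟩
  have hmain := norm_taylor_sub_le (by positivity : (0 : ℝ) < 1 / N) hΘC hΘB
  have hΘ0 : Θ 0 = that (ones N) := by simp [hΘ, hℓ0]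
  have hΘ1 : Θ (1 / N) = that (loo N i) := by
    simp [hΘ, hℓ, hN0.ne']
  have hder : ∀ k ∈ Finset.Icc 1 kIJ, (1 / (k.factorial : ℝ)) • (1 / (N : ℝ)) ^ k •
      iteratedDeriv k Θ 0 =
      (1 / (k.factorial : ℝ)) • dTheta that k (ones N) (loo N i - ones N) := by
    intro k hk
    have hk' : k ≤ kIJ + 1 := by simp at hk; omega
    -- The direction is multiplied by `N`, which cancels the factor `(1 / N) ^ k` of the Taylor
    -- term.
    have h1 : Θ = fun s : ℝ => that (ones N + s • ((N : ℝ) • (loo N i - ones N))) := by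
      funext s; simp only [hΘ, hℓ, smul_smul]
    rw [h1, iteratedDeriv_comp_line (hones.of_le (by exact_mod_cast hk')),
      ContinuousMultilinearMap.map_smul_univ]
    simp only [Finset.prod_const, Finset.card_univ, Fintype.card_fin, dTheta]
    congr 1
    rw [smul_smul, ← mul_pow, one_div, inv_mul_cancel₀ hN0.ne', one_pow, one_smul]
  rw [Finset.sum_congr rfl hder, hΘ0, hΘ1] at hmain
  refine hmain.trans (le_of_eq ?_)
  rw [one_div, inv_pow, div_eq_mul_inv]

end HOIJ

/-! ### Measure-theoretic tools -/

section Tightness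

variable {Ω : Type*} {mΩ : MeasurableSpace Ω} {P : Measure Ω}

theorem exists_measure_le_of_measure_iInter_eq_zero [IsFiniteMeasure P] {A : ℕ → Set Ω}
    (hA : ∀ n, MeasurableSet (A n)) (hanti : Antitone A) (h0 : P (⋂ n, A n) = 0) {ε : ENNReal}
    (hε : ε ≠ 0) : ∃ n, P (A n) ≤ ε := by
  have h := tendsto_measure_iInter_atTop (μ := P) (fun n => (hA n).nullMeasurableSet) hanti
    ⟨0, measure_ne_top _ _⟩
  rw [h0] at h
  obtain ⟨n, hn⟩ := (h.eventually (gt_mem_nhds (pos_iff_ne_zero.2 hε))).exists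
  exact ⟨n, hn.le⟩

theorem exists_measure_natCast_lt_le [IsFiniteMeasure P] {X : Ω → ℝ} (hX : Measurable X)
    {ε : ENNReal} (hε : ε ≠ 0) : ∃ n : ℕ, P {ω | (n : ℝ) < X ω} ≤ ε := by
  refine exists_measure_le_of_measure_iInter_eq_zero
    (fun n => measurableSet_lt measurable_const hX) (fun a b hab ω hω => ?_) ?_ hε
  · exact lt_of_le_of_lt (Nat.cast_le.2 hab : (a : ℝ) ≤ b) hω
  · have : ⋂ n : ℕ, {ω | (n : ℝ) < X ω} = ∅ := by
      refine Set.eq_empty_of_forall_notMem fun ω hω => ?_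
      obtain ⟨n, hn⟩ := exists_nat_ge (X ω)
      exact absurd (Set.mem_iInter.1 hω n) (not_lt.2 hn)
    rw [this, measure_empty]

/-- The σ-algebra `m` need not contain the null sets, so the limit is taken of `m`-measurable
versions, by `limUnder`, which is defined everywhere. -/
theorem aestronglyMeasurable_sub_of_tendsto_ae {E : Type*} [TopologicalSpace E]
    [TopologicalSpace.IsCompletelyMetrizableSpace E] [Nonempty E] {m : MeasurableSpace Ω}
    {f : ℕ → Ω → E} {F : Ω → E} (hf : ∀ n, AEStronglyMeasurable[m] (f n) P)
    (h : ∀ᵐ ω ∂P, Tendsto (fun n => f n ω) atTop (𝓝 (F ω))) : AEStronglyMeasurable[m] F P := by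
  choose Y hY hYe using hf
  refine ⟨fun ω => limUnder atTop fun n => Y n ω, StronglyMeasurable.limUnder hY, ?_⟩
  filter_upwards [ae_all_iff.2 hYe, h] with ω h1 h2
  simp only [h1] at h2
  exact h2.limUnder_eq.symm

/-- The sum is the expected cardinality of `S`. -/
theorem sum_measure_mem_finset_le [IsProbabilityMeasure P] {ι : Type*} [Fintype ι]
    {S : Ω → Finset ι} {n : ℕ} (hcard : ∀ ω, (S ω).card ≤ n)
    (hS : ∀ i, MeasurableSet {ω | i ∈ S ω}) : ∑ i, P {ω | i ∈ S ω} ≤ n := by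
  classical
  calc ∑ i, P {ω | i ∈ S ω} = ∑ i, ∫⁻ ω, {ω | i ∈ S ω}.indicator 1 ω ∂P :=
        Finset.sum_congr rfl fun i _ => (lintegral_indicator_one (hS i)).symm
    _ = ∫⁻ ω, ∑ i, {ω | i ∈ S ω}.indicator 1 ω ∂P :=
        (lintegral_finsetSum _ fun i _ => measurable_one.indicator (hS i)).symm
    _ ≤ ∫⁻ _, (n : ENNReal) ∂P := by
        refine lintegral_mono fun ω => ?_
        have : ∑ i, ({ω | i ∈ S ω}.indicator 1 ω : ENNReal) = (S ω).card := by
          simp [Set.indicator_apply]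
        rw [this]
        exact Nat.cast_le.2 (hcard ω)
    _ = n := by simp

end Tightness

/-! ### Tightness of the terms left out -/

namespace HOIJ

variable {D : ℕ} {Ω : Type*} {mΩ : MeasurableSpace Ω} {P : Measure Ω}

theorem continuousOn_derivArray {g : ℕ → Param D → Param D} {Ωθ : Set (Param D)} {kIJ : ℕ}
    (hopen : IsOpen Ωθ) (hd : Diffable g Ωθ kIJ) (n : ℕ) {k : ℕ} (hk : k ≤ kIJ + 1) :
    ContinuousOn (derivArray k (g n)) Ωθ := by
  intro θ hθ
  have h1 : ContDiffAt ℝ (kIJ + 1 : ℕ) (g n) θ := (hd n).contDiffAt (hopen.mem_nhds hθ)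
  have h2 : ContinuousAt (iteratedFDeriv ℝ k (g n)) θ :=
    (h1.iteratedFDeriv_right (m := 0) (by rw [zero_add]; exact_mod_cast hk)).continuousAt
  refine ContinuousAt.continuousWithinAt (continuousAt_pi.2 fun p => ?_)
  exact (PiLp.continuous_apply 2 _ p.2).continuousAt.comp
    ((ContinuousMultilinearMap.apply ℝ (fun _ : Fin k => Param D) (Param D) _).continuous
      |>.continuousAt.comp h2)

/-- Some array of partial derivatives of order at most `kIJ + 1` at a point of `Q` has an entry
larger than `K`. -/
def Exceeds {Ωθ : Set (Param D)} (kIJ : ℕ) (Q : Set Ωθ) (K : ℝ) (f : Param D → Param D) : Prop :=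
  ∃ k ≤ kIJ + 1, ∃ q ∈ Q, K < ‖derivArray k f q‖

/-- By continuity a bound on the dense set `Q` extends to `Ωθ`; a countable `Q` keeps the events
measurable. -/
theorem norm_derivArray_le_of_not_exceeds {g : ℕ → Param D → Param D} {Ωθ : Set (Param D)}
    {kIJ : ℕ} (hopen : IsOpen Ωθ) (hd : Diffable g Ωθ kIJ) {Q : Set Ωθ} (hQ : Dense Q) {K : ℝ}
    {n : ℕ} (h : ¬ Exceeds kIJ Q K (g n)) {k : ℕ} (hk : k ≤ kIJ + 1) {θ : Param D} (hθ : θ ∈ Ωθ) :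
    ‖derivArray k (g n) θ‖ ≤ K := by
  have hc : Continuous fun q : Ωθ => ‖derivArray k (g n) q‖ :=
    (continuousOn_iff_continuous_domRestrict.1 (continuousOn_derivArray hopen hd n hk)).norm
  have hsub : closure Q ⊆ {q : Ωθ | ‖derivArray k (g n) q‖ ≤ K} :=
    closure_minimal (fun q hq => le_of_not_gt fun hlt => h ⟨k, hk, q, hq, hlt⟩)
      (isClosed_le hc continuous_const)
  exact hsub (hQ ⟨θ, hθ⟩)

/-- The derivatives of the `n`-th term are bounded in probability, uniformly in `n`. -/
theorem exists_measure_exceeds_le [IsProbabilityMeasure P] {g : ℕ → Ω → Param D → Param D}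
    {Ωθ : Set (Param D)} {kIJ : ℕ} (hiid : CondIID P g Ωθ kIJ)
    (hsup : ∀ᵐ ω ∂P, SupTerms (fun n => g n ω) Ωθ kIJ) {Q : Set Ωθ} (hQ : Q.Countable)
    {δ : ENNReal} (hδ : δ ≠ 0) :
    ∃ K : ℕ, ∀ n ≥ 1, P {ω | Exceeds kIJ Q K (g n ω)} ≤ δ := by
  have hdiv : δ / (kIJ + 2 : ℕ) ≠ 0 := ENNReal.div_ne_zero.2 ⟨hδ, ENNReal.natCast_ne_top _⟩
  let W : (k : ℕ) → ℝ → Set (Ωθ → (Fin k → Fin D) × Fin D → ℝ) := fun k K =>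
    ⋃ q ∈ Q, {f | K < ‖f q‖}
  have hW : ∀ k K, MeasurableSet (W k K) := fun k K =>
    MeasurableSet.biUnion hQ fun q _ => measurableSet_lt measurable_const
      (measurable_pi_apply q).norm
  have hmem : ∀ (k : ℕ) (K : ℝ) (n : ℕ) (ω : Ω),
      ω ∈ (fun (ω : Ω) (θ : Ωθ) => derivArray k (g n ω) θ) ⁻¹' W k K ↔
        ∃ q ∈ Q, K < ‖derivArray k (g n ω) q‖ := by
    intro k K n ω
    simp [W]
  have hex : ∀ k ≤ kIJ + 1, ∃ K : ℕ,
      P ((fun (ω : Ω) (θ : Ωθ) => derivArray k (g 1 ω) θ) ⁻¹' W k K) ≤ δ / (kIJ + 2 : ℕ) := by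
    intro k hk
    have hm : Measurable (fun (ω : Ω) (θ : Ωθ) => derivArray k (g 1 ω) θ) :=
      measurable_pi_iff.2 fun θ => (hiid k hk).1 1 le_rfl θ θ.2
    refine exists_measure_le_of_measure_iInter_eq_zero (fun n => hm (hW k n))
      (fun a b hab ω hω => ?_) ?_ hdiv
    · obtain ⟨q, hq, hlt⟩ := (hmem k b 1 ω).1 hω
      exact (hmem k a 1 ω).2 ⟨q, hq, lt_of_le_of_lt (by exact_mod_cast hab) hlt⟩
    -- An outcome in all these events has an infinite supremum, which has probability zero.
    · refine measure_mono_null (fun ω hω => ?_) (ae_iff.1 hsup)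
      intro hs
      obtain ⟨b, hb⟩ := hs k hk 1 le_rfl
      obtain ⟨n, hn⟩ := exists_nat_ge b
      obtain ⟨q, -, hlt⟩ := (hmem k n 1 ω).1 (Set.mem_iInter.1 hω n)
      exact absurd (hb ⟨q, q.2, rfl⟩) (not_le.2 (hn.trans_lt hlt))
  have hex' : ∀ k, ∃ K : ℕ, k ≤ kIJ + 1 →
      P ((fun (ω : Ω) (θ : Ωθ) => derivArray k (g 1 ω) θ) ⁻¹' W k K) ≤ δ / (kIJ + 2 : ℕ) := by
    intro k
    by_cases hk : k ≤ kIJ + 1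
    · obtain ⟨K, hK⟩ := hex k hk
      exact ⟨K, fun _ => hK⟩
    · exact ⟨0, fun h => absurd h hk⟩
  choose K hK using hex'
  refine ⟨(Finset.range (kIJ + 2)).sup K, fun n hn => ?_⟩
  have hsub : {ω | Exceeds kIJ Q ((Finset.range (kIJ + 2)).sup K : ℕ) (g n ω)} ⊆
      ⋃ k ∈ Finset.range (kIJ + 2),
        (fun (ω : Ω) (θ : Ωθ) => derivArray k (g n ω) θ) ⁻¹' W k (K k) := by
    rintro ω ⟨k, hk, q, hq, hlt⟩
    have hk' : k ∈ Finset.range (kIJ + 2) := Finset.mem_range.2 (by omega)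
    refine Set.mem_biUnion hk' ((hmem k (K k) n ω).2 ⟨q, hq, lt_of_le_of_lt ?_ hlt⟩)
    exact_mod_cast Finset.le_sup (f := K) hk'
  refine (measure_mono hsub).trans ((measure_biUnion_finset_le _ _).trans ?_)
  calc _ ≤ ∑ _k ∈ Finset.range (kIJ + 2), δ / (kIJ + 2 : ℕ) := by
        refine Finset.sum_le_sum fun k hk => ?_
        have hk' : k ≤ kIJ + 1 := by simp at hk; omega
        rw [((hiid k hk').2.2.1 n hn).measure_mem_eq (hW k _)]
        exact hK k hk'
    _ = δ := by
        rw [Finset.sum_const, Finset.card_range, nsmul_eq_mul]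
        exact ENNReal.mul_div_cancel (by simp) (ENNReal.natCast_ne_top _)

theorem tendsto_difference_quotient {f : Param D → Param D} {θ : Param D} {k : ℕ}
    (hf : ContDiffAt ℝ (k + 1 : ℕ) f θ) (e : Param D) (v : Fin k → Param D) (a : ℕ) :
    Tendsto (fun n : ℕ => ((n + a : ℕ) + 1 : ℝ) •
      (iteratedFDeriv ℝ k f (θ + ((n + a : ℕ) + 1 : ℝ)⁻¹ • e) v - iteratedFDeriv ℝ k f θ v)) atTop
      (𝓝 (iteratedFDeriv ℝ (k + 1) f θ (Fin.cons e v))) := by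
  have hd : DifferentiableAt ℝ (iteratedFDeriv ℝ k f) θ :=
    (hf.iteratedFDeriv_right (m := 1) (by norm_cast; omega)).differentiableAt one_ne_zero
  have h1 : HasFDerivAt (fun z => iteratedFDeriv ℝ k f z v)
      ((ContinuousMultilinearMap.apply ℝ (fun _ : Fin k => Param D) (Param D) v).comp
        (fderiv ℝ (iteratedFDeriv ℝ k f) θ)) θ :=
    (ContinuousMultilinearMap.apply ℝ (fun _ : Fin k => Param D) (Param D)
      v).hasFDerivAt.comp θ hd.hasFDerivAt
  have h2 := h1.lim_real e
  have h3 : Tendsto (fun n : ℕ => ((n + a : ℕ) + 1 : ℝ)) atTop atTop :=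
    (tendsto_natCast_atTop_atTop.comp (tendsto_add_atTop_nat a)).atTop_add tendsto_const_nhds
  have h4 := h2.comp h3
  simpa [Function.comp_def, iteratedFDeriv_succ_apply_left] using h4

/-- The index set is independent of the values of the terms only, so derivatives must be recovered
from values: by induction, as almost sure limits of difference quotients. The offset `a` keeps the
shifted points in `Ωθ`. -/
theorem aestronglyMeasurable_iteratedFDeriv {g : ℕ → Ω → Param D → Param D} {Ωθ : Set (Param D)}
    {kIJ n : ℕ} (hopen : IsOpen Ωθ) (hdiff : ∀ᵐ ω ∂P, Diffable (fun n => g n ω) Ωθ kIJ)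
    {m : MeasurableSpace Ω} (hm : ∀ θ ∈ Ωθ, Measurable[m] fun ω => g n ω θ) (k : ℕ)
    (hk : k ≤ kIJ + 1) {θ : Param D} (hθ : θ ∈ Ωθ) (v : Fin k → Param D) :
    AEStronglyMeasurable[m] (fun ω => iteratedFDeriv ℝ k (g n ω) θ v) P := by
  induction k generalizing θ with
  | zero =>
    simp only [iteratedFDeriv_zero_apply]
    exact (hm θ hθ).stronglyMeasurable.aestronglyMeasurable
  | succ k ih =>
    have hnear : ∀ᶠ a : ℕ in atTop, θ + ((a : ℝ) + 1)⁻¹ • v 0 ∈ Ωθ := by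
      have h1 : Tendsto (fun a : ℕ => θ + ((a : ℝ) + 1)⁻¹ • v 0) atTop (𝓝 θ) := by
        have := (tendsto_one_div_add_atTop_nhds_zero_nat (𝕜 := ℝ)).smul_const (v 0)
        simpa using this.const_add θ
      exact h1.eventually (hopen.mem_nhds hθ)
    obtain ⟨a, ha⟩ := eventually_atTop.1 hnear
    refine aestronglyMeasurable_sub_of_tendsto_ae (f := fun (j : ℕ) ω => ((j + a : ℕ) + 1 : ℝ) •
      (iteratedFDeriv ℝ k (g n ω) (θ + ((j + a : ℕ) + 1 : ℝ)⁻¹ • v 0) (Fin.tail v) -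
        iteratedFDeriv ℝ k (g n ω) θ (Fin.tail v))) (fun j => ?_) ?_
    · exact ((ih (by omega) (ha (j + a) (by omega)) _).sub (ih (by omega) hθ _)).const_smul
        ((j + a : ℕ) + 1 : ℝ)
    · filter_upwards [hdiff] with ω hω
      have hC : ContDiffAt ℝ (k + 1 : ℕ) (g n ω) θ :=
        ((hω n).contDiffAt (hopen.mem_nhds hθ)).of_le (by exact_mod_cast hk)
      have := tendsto_difference_quotient hC (v 0) (Fin.tail v) a
      rwa [Fin.cons_self_tail] at this

/-- The event `Exceeds` is determined, up to a null set, by the values of the random function. -/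
theorem exists_measurableSet_ae_eq_exceeds {g : ℕ → Ω → Param D → Param D} {Ωθ : Set (Param D)}
    {kIJ n : ℕ} (hopen : IsOpen Ωθ) (hdiff : ∀ᵐ ω ∂P, Diffable (fun n => g n ω) Ωθ kIJ)
    {m : MeasurableSpace Ω} (hm : ∀ θ ∈ Ωθ, Measurable[m] fun ω => g n ω θ) {Q : Set Ωθ}
    (hQ : Q.Countable) (K : ℝ) :
    ∃ A, MeasurableSet[m] A ∧ A =ᵐ[P] {ω | Exceeds kIJ Q K (g n ω)} := by
  have key : ∀ (k : ℕ) (q : Ωθ), ∃ Y : Ω → ((Fin k → Fin D) × Fin D → ℝ), Measurable[m] Y ∧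
      (k ≤ kIJ + 1 → ∀ᵐ ω ∂P, derivArray k (g n ω) q = Y ω) := by
    intro k q
    by_cases hk : k ≤ kIJ + 1
    swap
    · exact ⟨fun _ => 0, measurable_const, fun h => absurd h hk⟩
    have hae : ∀ p : (Fin k → Fin D) × Fin D,
        AEStronglyMeasurable[m] (fun ω => derivArray k (g n ω) q p) P := by
      intro p
      obtain ⟨Z, hZ, hZe⟩ := aestronglyMeasurable_iteratedFDeriv hopen hdiff hm k hk q.2
        (fun l => EuclideanSpace.single (p.1 l) (1 : ℝ))
      refine ⟨fun ω => Z ω p.2, (PiLp.continuous_apply 2 _ p.2).comp_stronglyMeasurable hZ, ?_⟩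
      filter_upwards [hZe] with ω hω
      exact congrArg (fun z : Param D => z p.2) hω
    refine ⟨fun ω p => (hae p).mk _ ω, measurable_pi_iff.2 fun p =>
      (hae p).stronglyMeasurable_mk.measurable, fun _ => ?_⟩
    filter_upwards [ae_all_iff.2 fun p => (hae p).ae_eq_mk] with ω hω
    exact funext hω
  choose Y hY hYe using key
  refine ⟨⋃ k ∈ Set.Iic (kIJ + 1), ⋃ q ∈ Q, {ω | K < ‖Y k q ω‖}, ?_, ?_⟩
  · exact MeasurableSet.biUnion (Set.to_countable _) fun k _ =>
      MeasurableSet.biUnion hQ fun q _ => measurableSet_lt measurable_const (hY k q).norm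
  · have hall : ∀ᵐ ω ∂P, ∀ k, k ≤ kIJ + 1 → ∀ q ∈ Q, derivArray k (g n ω) q = Y k q ω := by
      rw [ae_all_iff]
      intro k
      by_cases hk : k ≤ kIJ + 1
      · filter_upwards [(ae_ball_iff hQ).2 fun q _ => hYe k q hk] with ω hω _ using hω
      · exact Eventually.of_forall fun _ h => absurd h hk
    rw [eventuallyEq_set]
    filter_upwards [hall] with ω hω
    simp only [Set.mem_iUnion, Set.mem_Iic, Set.mem_ofPred_eq, exists_prop, Exceeds]
    refine exists_congr fun k => and_congr_right fun hk => exists_congr fun q =>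
      and_congr_right fun hq => ?_
    rw [hω k hk q hq]

/-- Few random indices, independent of the terms, avoid the terms with large derivatives. -/
theorem measure_exists_exceeds_le [IsProbabilityMeasure P] {g : ℕ → Ω → Param D → Param D}
    {Ωθ : Set (Param D)} {kIJ Nloo : ℕ} {S : (N : ℕ) → Ω → Finset (Fin N)} (hopen : IsOpen Ωθ)
    (hdiff : ∀ᵐ ω ∂P, Diffable (fun n => g n ω) Ωθ kIJ)
    (hS : RandomIndices P g Ωθ Nloo S) {Q : Set Ωθ} (hQ : Q.Countable) {K : ℝ} {δ : ENNReal}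
    (hK : ∀ n ≥ 1, P {ω | Exceeds kIJ Q K (g n ω)} ≤ δ) (N : ℕ) :
    P {ω | ∃ i ∈ S N ω, Exceeds kIJ Q K (g (i + 1) ω)} ≤ Nloo * δ := by
  obtain ⟨hcard, hmeas, hind⟩ := hS N
  have hpre : ∀ i : Fin N, {ω | i ∈ S N ω} = S N ⁻¹' {s | i ∈ s} := fun i => rfl
  have hSm : ∀ i : Fin N, MeasurableSet {ω | i ∈ S N ω} := by
    intro i
    have : {ω | i ∈ S N ω} = ⋃ s ∈ {s : Finset (Fin N) | i ∈ s}, S N ⁻¹' {s} := by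
      ext ω; simp
    rw [this]
    exact MeasurableSet.biUnion (Set.to_countable _) fun s _ => hmeas s
  have hone : ∀ i : Fin N, P ({ω | i ∈ S N ω} ∩ {ω | Exceeds kIJ Q K (g (i + 1) ω)}) ≤
      P {ω | i ∈ S N ω} * δ := by
    intro i
    have hm : ∀ θ ∈ Ωθ, Measurable[MeasurableSpace.comap
        (fun (ω : Ω) (p : Fin (N + 1) × Ωθ) => g p.1 ω p.2) MeasurableSpace.pi]
        fun ω => g (i + 1) ω θ := fun θ hθ =>
      Measurable.comp (g := fun f : Fin (N + 1) × Ωθ → Param D => f (i.succ, ⟨θ, hθ⟩))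
        (measurable_pi_apply _)
        (comap_measurable fun (ω : Ω) (p : Fin (N + 1) × Ωθ) => g p.1 ω p.2)
    -- Independence applies to `A`, a version of the event in the σ-algebra of the values.
    obtain ⟨A, hA, hAe⟩ := exists_measurableSet_ae_eq_exceeds hopen hdiff hm hQ K
    have h1 := (Indep_iff _ _ _).1 hind {ω | i ∈ S N ω} A ⟨{s | i ∈ s}, trivial, rfl⟩ hA
    rw [← measure_congr ((ae_eq_refl _).inter hAe), h1, measure_congr hAe]
    gcongr
    exact hK _ (by omega)
  have hsub : {ω | ∃ i ∈ S N ω, Exceeds kIJ Q K (g (i + 1) ω)} ⊆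
      ⋃ i ∈ (Finset.univ : Finset (Fin N)),
        ({ω | i ∈ S N ω} ∩ {ω | Exceeds kIJ Q K (g (i + 1) ω)}) := by
    rintro ω ⟨i, hi, h⟩
    exact Set.mem_biUnion (Finset.mem_coe.2 (Finset.mem_univ i)) ⟨hi, h⟩
  calc _ ≤ ∑ i : Fin N, P ({ω | i ∈ S N ω} ∩ {ω | Exceeds kIJ Q K (g (i + 1) ω)}) :=
        (measure_mono hsub).trans (measure_biUnion_finset_le _ _)
    _ ≤ ∑ i : Fin N, P {ω | i ∈ S N ω} * δ := Finset.sum_le_sum fun i _ => hone i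
    _ = (∑ i : Fin N, P {ω | i ∈ S N ω}) * δ := (Finset.sum_mul _ _ _).symm
    _ ≤ Nloo * δ := by
        gcongr
        exact sum_measure_mem_finset_le hcard hSm

end HOIJ

/-! ### Assembly -/

namespace HOIJ

theorem ThetaDom.isOpen {D N : ℕ} {g : ℕ → Param D → Param D} {Ωθ : Set (Param D)} {r ρ : ℝ}
    {that : Weight N → Param D} {w : Weight N} (h : ThetaDom g Ωθ r ρ that w) : IsOpen Ωθ :=
  h.2.1

theorem Convexity.mono {D N : ℕ} {g : ℕ → Param D → Param D} {Ωθ : Set (Param D)} {c c' : ℝ}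
    (h : Convexity g Ωθ N c) (hc : c ≤ c') : Convexity g Ωθ N c' :=
  fun θ hθ => ⟨(h θ hθ).1, (h θ hθ).2.trans hc⟩

/-- Neither `p` nor `bad` need be measurable; the complement of a measurable hull is used. -/
theorem exists_measurableSet_forall_mem {Ω : Type*} [MeasurableSpace Ω] {P : Measure Ω}
    [IsProbabilityMeasure P] {p : Ω → Prop} (hp : ∀ᵐ ω ∂P, p ω) {bad : Set Ω} {ε : ℝ} (hε : 0 < ε)
    (h : P bad ≤ ENNReal.ofReal ε) :
    ∃ A : Set Ω, MeasurableSet A ∧ ENNReal.ofReal (1 - ε) ≤ P A ∧ ∀ ω ∈ A, p ω ∧ ω ∉ bad := by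
  have h' : P ({ω | ¬ p ω} ∪ bad) ≤ ENNReal.ofReal ε := by
    refine (measure_union_le _ _).trans ?_
    rwa [ae_iff.1 hp, zero_add]
  refine ⟨(toMeasurable P ({ω | ¬ p ω} ∪ bad))ᶜ, (measurableSet_toMeasurable P _).compl, ?_,
    fun ω hω => ⟨?_, fun hb => hω (subset_toMeasurable P _ (Or.inr hb))⟩⟩
  · rw [prob_compl_eq_one_sub (measurableSet_toMeasurable P _), measure_toMeasurable,
      ENNReal.ofReal_sub _ hε.le, ENNReal.ofReal_one]
    exact tsub_le_tsub_left h' 1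
  · by_contra hb
    exact hω (subset_toMeasurable P _ (Or.inl hb))

end HOIJ

theorem mainTheorem7 {D : ℕ} {Ω : Type*} [MeasurableSpace Ω] (P : Measure Ω)
    [IsProbabilityMeasure P] (kIJ Nloo N₁ : ℕ) (hN₁ : 1 ≤ N₁)
    -- the random functions `g_0, g_1, …`, the domain, and the estimators
    (g : ℕ → Ω → HOIJ.Param D → HOIJ.Param D) (Ωθ : Set (HOIJ.Param D))
    (that : (N : ℕ) → Ω → HOIJ.Weight N → HOIJ.Param D)
    -- the random leave-one-out indices
    (S : (N : ℕ) → Ω → Finset (Fin N))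
    -- the two enlargement radii; that of the weight domain may depend on `N`
    (r : ℝ) (hr : 0 < r) (ρ : ℕ → ℝ) (hρ : ∀ N, 0 < ρ N)
    -- bounds that do not depend on `N` (they may be random; constants are a special case)
    (Cop : Ω → ℝ) (hCop : Measurable Cop) (M : ℕ → Ω → ℝ) (hM : ∀ k, Measurable (M k))
    (hiid : HOIJ.CondIID P g Ωθ kIJ)
    (hsup : ∀ᵐ ω ∂P, HOIJ.SupTerms (fun n => g n ω) Ωθ kIJ)
    (hS : HOIJ.RandomIndices P g Ωθ Nloo S)
    (hdom : ∀ᵐ ω ∂P, ∀ N ≥ N₁, ∀ i ∈ S N ω,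
      HOIJ.ThetaDom (fun n => g n ω) Ωθ r (ρ N) (that N ω) (HOIJ.loo N i))
    (hdiff : ∀ᵐ ω ∂P, HOIJ.Diffable (fun n => g n ω) Ωθ kIJ)
    (hconv : ∀ᵐ ω ∂P, ∀ N ≥ N₁, HOIJ.Convexity (fun n => g n ω) Ωθ N (Cop ω))
    (hbdd : ∀ᵐ ω ∂P, ∀ N ≥ N₁,
      HOIJ.Bounded (fun n => g n ω) Ωθ kIJ N (fun k => M k ω)) :
    ∀ ε : ℝ, 0 < ε → ∃ (C : ℝ) (N₀ : ℕ), ∀ N ≥ N₀, ∃ A : Set Ω,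
      MeasurableSet A ∧ ENNReal.ofReal (1 - ε) ≤ P A ∧
      ∀ ω ∈ A, ∀ i ∈ S N ω,
        ContDiffAt ℝ kIJ (that N ω) (HOIJ.ones N) ∧
        HOIJ.errIJ (that N ω) kIJ (HOIJ.loo N i) ≤ C / (N : ℝ) ^ (kIJ + 1) := by
  intro ε hε
  -- Openness of `Ωθ` is known only when some index is drawn. If it fails, almost surely no index is
  -- drawn for `N ≥ N₁`, and the claim is vacuous.
  by_cases hopen : IsOpen Ωθ
  swap
  · refine ⟨0, N₁, fun N hN => ?_⟩
    obtain ⟨A, hA, hPA, hAb⟩ := HOIJ.exists_measurableSet_forall_mem hdom (bad := ∅) hε (by simp)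
    refine ⟨A, hA, hPA, fun ω hω i hi => ?_⟩
    exact absurd ((hAb ω hω).1 N hN i hi).isOpen hopen
  obtain ⟨Q, hQc, hQd⟩ := TopologicalSpace.exists_countable_dense Ωθ
  set η : ENNReal := ENNReal.ofReal (ε / 2) with hη
  have hη0 : η ≠ 0 := (ENNReal.ofReal_pos.2 (half_pos hε)).ne'
  -- The divisor `Nloo + 1` is nonzero even if `Nloo = 0`. Half of `ε` is spent here, half on the
  -- random bounds `Cop` and `M`.
  obtain ⟨K, hK⟩ := HOIJ.exists_measure_exceeds_le hiid hsup hQc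
    (ENNReal.div_ne_zero.2 ⟨hη0, ENNReal.natCast_ne_top (Nloo + 1)⟩)
  have hXm : Measurable fun ω => |Cop ω| + ∑ k ∈ Finset.range (kIJ + 2), |M k ω| :=
    hCop.abs.add (Finset.measurable_sum _ fun k _ => (hM k).abs)
  obtain ⟨L, hL⟩ := exists_measure_natCast_lt_le (P := P) hXm hη0
  obtain ⟨C, N₀, hC⟩ := HOIJ.exists_errIJ_le D kIJ hr (c := L) (m := max K L)
    (Nat.cast_nonneg L) (le_max_of_le_left (Nat.cast_nonneg K))
  refine ⟨C, max N₀ N₁, fun N hN => ?_⟩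
  have hN0 : N₀ ≤ N := (le_max_left _ _).trans hN
  have hN1 : N₁ ≤ N := (le_max_right _ _).trans hN
  have hall := hsup.and (hdom.and (hdiff.and (hconv.and hbdd)))
  set large := {ω | ∃ i ∈ S N ω, HOIJ.Exceeds kIJ Q (K : ℝ) (g (i + 1) ω)}
  set wide := {ω | (L : ℝ) < |Cop ω| + ∑ k ∈ Finset.range (kIJ + 2), |M k ω|}
  have hlarge : P large ≤ η := by
    refine (HOIJ.measure_exists_exceeds_le hopen hdiff hS hQc hK N).trans ?_
    calc (Nloo : ENNReal) * (η / (Nloo + 1 : ℕ)) ≤ (Nloo + 1 : ℕ) * (η / (Nloo + 1 : ℕ)) := by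
          gcongr
          omega
      _ = η := ENNReal.mul_div_cancel (by simp) (ENNReal.natCast_ne_top _)
  have hbad : P (large ∪ wide) ≤ ENNReal.ofReal ε := by
    refine (measure_union_le _ _).trans ((add_le_add hlarge hL).trans (le_of_eq ?_))
    rw [hη, ← ENNReal.ofReal_add (by positivity) (by positivity), add_halves]
  obtain ⟨A, hA, hPA, hAb⟩ := HOIJ.exists_measurableSet_forall_mem hall hε hbad
  refine ⟨A, hA, hPA, fun ω hω i hi => ?_⟩
  obtain ⟨⟨gsup, gdom, gdiff, gconv, gbdd⟩, hnot⟩ := hAb ω hω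
  have hnl : ω ∉ large := fun h => hnot (Or.inl h)
  have hnw : ω ∉ wide := fun h => hnot (Or.inr h)
  have hX : |Cop ω| + ∑ k ∈ Finset.range (kIJ + 2), |M k ω| ≤ L := not_lt.1 hnw
  have hsum : 0 ≤ ∑ k ∈ Finset.range (kIJ + 2), |M k ω| :=
    Finset.sum_nonneg fun _ _ => abs_nonneg _
  have hCL : Cop ω ≤ L := by linarith [le_abs_self (Cop ω)]
  have hML : ∀ k ≤ kIJ + 1, M k ω ≤ L := by
    intro k hk
    have h1 := Finset.single_le_sum (f := fun k => |M k ω|) (fun _ _ => abs_nonneg _)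
      (Finset.mem_range.2 (by omega : k < kIJ + 2))
    linarith [le_abs_self (M k ω), abs_nonneg (Cop ω)]
  refine hC N hN0 (fun n => g n ω) Ωθ (ρ N) (that N ω) i (hρ N) (gdom N hN1 i hi) gdiff
    ((gconv N hN1).mono hCL)
    (fun k h1 h2 θ hθ => (gbdd N hN1 k h1 h2 θ hθ).trans ((hML k h2).trans (le_max_right _ _)))
    gsup fun k hk θ hθ => ?_
  exact (HOIJ.norm_derivArray_le_of_not_exceeds hopen gdiff hQd (n := i + 1)
    (fun h => hnl ⟨i, hi, h⟩) hk hθ).trans (le_max_left _ _)
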